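/- Let $Y_1,Y_2,\dots$ be i.i.d. real random variables whose distribution function $F$ is continuous and satisfies, for all large $y$, $1-F(y)=e^{-L(y)y^\rho}$ with $\rho>1$, where $L$ is slowly varying ($L(ty)/L(y)\to1$ as $y\to\infty$ for every $t>0$), twice differentiable for all large $y$, and $yL'(y)/L(y)\to0$, $\bigl(yL'(y)/L(y)\bigr)'\to0$ as $y\to\infty$. Write $F^{-1}(p)=\inf\{x: F(x)\ge p\}$, $U(t)=F^{-1}(1-1/t)$ for $t>1$, and $a(t)=U(et)-U(t)$ (the usual scale of the Gumbel domain of attraction). For $k\ge2$ let $\zeta(1;k-1)=\sum_{j=1}^{k-1}1/j$, let $\gamma$ be Euler's constant, and put $$\alpha_1=\dots=\alpha_{k-1}=\frac{\zeta(1;k-1)-\gamma}{k-1},\qquad \alpha_k=1-(k-1)\alpha_1,\qquad \Omega_k(y)=\sum_{i=1}^k\alpha_i y_i\ \ (y\in\mathbb R^k),\qquad \sigma_k=\frac{\zeta(1;k-1)-\gamma}{\sqrt{k-1}} .$$ Let $\Lambda^{(k)}$ be the law on $\mathbb R^k$ with density $\mathbf 1_{g_1>\dots>g_k}\exp\bigl(-e^{-g_k}-\sum_{i=1}^k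 g_i\bigr)$, and let $\Omega_{k,n}=\Omega_k(Y_{1,n},\dots,Y_{k,n})$, where $Y_{1,n}\ge\dots\ge Y_{n,n}$ are $Y_1,\dots,Y_n$ in decreasing order. Then $\Omega_k$ is asymptotically normal, in the following senses. (1) If, for each $k$, $G^{(k)}$ is a random vector with law $\Lambda^{(k)}$, then $\Omega_k(G^{(k)})/\sigma_k\to\mathcal N(0,1)$ in distribution as $k\to\infty$. (2) For every sequence $k=k(n)$ of natural numbers with $k\to\infty$ and $k/n\to0$ as $n\to\infty$, there are real numbers $c_n$ such that $$\frac{\Omega_{k,n}-c_n}{a(n/k)\,\sigma_k}\longrightarrow\mathcal N(0,1)\quad\text{in distribution as } n\to\infty .$$ (3) There is a sequence $\kappa(n)$ of natural numbers with $\kappa(n)\to\infty$ and $\kappa(n)/n\to0$ such that for every sequence $k=k(n)$ with $k\to\infty$ and $k(n)\le\kappa(n)$ for all large $n$, $$\frac{\Omega_{k,n}-F^{-1}(1-1/n)}{a(n)\,\sigma_k}\longrightarrow\mathcal N(0,1)\quad\text{in distribution as } n\to\infty .$$ -/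

import Mathlib

open MeasureTheory ProbabilityTheory Filter Topology

/-- The class of laws of `Y` (the log-exponential-power class for `X = exp Y`): the distribution
function is continuous and `1 - F(y) = exp (-h(y))` with `h(y) = L(y) * y ^ ρ`, `ρ > 1`, where `L` is
slowly varying, twice differentiable, `y L'(y) / L(y) → 0` and `(y L'(y) / L(y))' → 0` as `y → ∞`.
Only the behaviour of `L` for large `y` matters. -/
structure IsLogExpPowerLaw (μ : Measure ℝ) (ρ : ℝ) : Prop where
  continuous_cdf : Continuous (cdf μ)
  one_lt : 1 < ρ
  exists_slowlyVarying : ∃ L : ℝ → ℝ,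
    (∀ᶠ y in atTop, 1 - cdf μ y = Real.exp (-(L y * y ^ ρ))) ∧
    (∀ t : ℝ, 0 < t → Tendsto (fun y => L (t * y) / L y) atTop (𝓝 1)) ∧
    (∀ᶠ y in atTop, DifferentiableAt ℝ L y ∧ DifferentiableAt ℝ (deriv L) y) ∧
    Tendsto (fun y => y * (deriv L y / L y)) atTop (𝓝 0) ∧
    Tendsto (deriv fun y => y * (deriv L y / L y)) atTop (𝓝 0)

/-- The generalized inverse `F⁻¹(p) = inf {x | p ≤ F(x)}` of the distribution function of `μ`. -/
noncomputable def quantile (μ : Measure ℝ) (p : ℝ) : ℝ :=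
  sInf {x : ℝ | p ≤ cdf μ x}

/-- The tail quantile `U(t) = F⁻¹(1 - 1/t)`, for `t > 1`. -/
noncomputable def tailQuantile (μ : Measure ℝ) (t : ℝ) : ℝ :=
  quantile μ (1 - 1 / t)

/-- The usual scale `a(t) = U(e t) - U(t)` of the Gumbel domain of attraction. -/
noncomputable def gumbelScale (μ : Measure ℝ) (t : ℝ) : ℝ :=
  tailQuantile μ (Real.exp 1 * t) - tailQuantile μ t

/-- `descOrderStat x i` is the `(i + 1)`-th largest value of the sample `x`
(so `i = 0` gives the maximum); it is `0` if the sample has at most `i` elements. -/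
noncomputable def descOrderStat {n : ℕ} (x : Fin n → ℝ) (i : ℕ) : ℝ :=
  if h : i < n then x (Tuple.sort x (Fin.rev ⟨i, h⟩)) else 0

/-- `ζ(1; k - 1) - γ`, where `ζ(1; m) = 1 + 1/2 + ⋯ + 1/m` and `γ` is Euler's constant. -/
noncomputable def zetaGap (k : ℕ) : ℝ :=
  (harmonic (k - 1) : ℝ) - Real.eulerMascheroniConstant

/-- The weights `α₁ = ⋯ = α_{k-1} = (ζ(1; k - 1) - γ) / (k - 1)` and `α_k = 1 - (k - 1) α₁`. -/
noncomputable def omegaWeight (k : ℕ) (i : Fin k) : ℝ :=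
  if (i : ℕ) + 1 = k then 1 - ((k : ℝ) - 1) * (zetaGap k / ((k : ℝ) - 1))
  else zetaGap k / ((k : ℝ) - 1)

/-- The linear combination `Ω_k = ∑ α_i y_i` of a decreasingly ordered vector `y`. -/
noncomputable def omegaStat (k : ℕ) (y : Fin k → ℝ) : ℝ :=
  ∑ i, omegaWeight k i * y i

/-- `Ω_k` applied to the `k` largest values of the first `n` observations. -/
noncomputable def omegaSample {Ω : Type*} (Y : ℕ → Ω → ℝ) (n k : ℕ) (ω : Ω) : ℝ :=
  omegaStat k fun i => descOrderStat (fun j : Fin n => Y j ω) i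

/-- The normalization `(ζ(1; k - 1) - γ) / √(k - 1)`. -/
noncomputable def omegaScale (k : ℕ) : ℝ :=
  zetaGap k / √((k : ℝ) - 1)

/-- The law `Λ^(k)` on `ℝ^k` with density `1_{g₁ > ⋯ > g_k} exp (-exp (-g_k) - ∑ g_i)`
(for `k = 0`, the unit mass on the one-point space). -/
noncomputable def gumbelTopLaw : (k : ℕ) → Measure (Fin k → ℝ)
  | 0 => Measure.dirac 0
  | m + 1 => volume.withDensity <| Set.indicator {g | StrictAnti g} fun g =>
      ENNReal.ofReal (Real.exp (-Real.exp (-g (Fin.last m)) - ∑ i, g i))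

/-
Write `Q s = U (exp s)`, so that the observations are `Q` of independent standard exponential
variables. By Rényi's representation, given the `k`-th largest exponential value `T`, the values
above it behave as `T + e i` with `k - 1` fresh exponential variables `e i`, so that with
`z = ζ(1; k - 1) - γ` the statistic `Ω_k` has the law of
`Q T + z / (k - 1) * ∑ (Q (T + e i) - Q T)`.

The tail condition says that `Q` inverts a function of elasticity tending to `ρ > 1`, hence near
`log (n / k)` it is almost linear with slope `a (n / k)`, and the sum of the excesses obeys the
central limit theorem of the exponential law. The fluctuation of `T` has order `1 / √k`, just as
that of the mean of the `e i`, but only the latter is multiplied by `z`, which tends to infinity: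
this is why the threshold drops out of the limit. The law `Λ^(k)` is the exactly linear case
`Q = id`, with `T` the Gumbel-type variable `g_k`.

For fixed `k` the resulting centring differs from `U n` by `(z - log k + o(1)) * a n`, and
`z - log k = O(1 / k)` is negligible against `σ_k = z / √(k - 1)`; letting `k` grow slowly enough
keeps the `o(1)` negligible too.
-/

theorem omegaStat_succ (m : ℕ) (y : Fin (m + 1) → ℝ) :
    omegaStat (m + 1) y = y (Fin.last m) +
      zetaGap (m + 1) / m * ∑ i : Fin m, (y i.castSucc - y (Fin.last m)) := by
  have weight_castSucc (i : Fin m) : omegaWeight (m + 1) i.castSucc = zetaGap (m + 1) / m := by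
    simp [omegaWeight, i.2.ne]
  have weight_last : omegaWeight (m + 1) (Fin.last m) = 1 - m * (zetaGap (m + 1) / m) := by
    simp [omegaWeight]
  simp only [omegaStat, Fin.sum_univ_castSucc, weight_castSucc, weight_last,
    Finset.sum_sub_distrib, ← Finset.mul_sum, Finset.sum_const, Finset.card_univ,
    Fintype.card_fin, nsmul_eq_mul]
  ring

theorem measurable_omegaStat (k : ℕ) : Measurable (omegaStat k) := by
  unfold omegaStat
  fun_prop

section DescOrderStat

variable {n : ℕ}

theorem descOrderStat_fin (x : Fin n → ℝ) (i : Fin n) :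
    descOrderStat x i = x (Tuple.sort x i.rev) := by
  simp [descOrderStat]

theorem antitone_descOrderStat (x : Fin n → ℝ) : Antitone fun i : Fin n => descOrderStat x i := by
  intro i j hij
  simp only [descOrderStat_fin]
  exact Tuple.monotone_sort x (Fin.rev_le_rev.2 hij)

theorem sum_descOrderStat (x : Fin n → ℝ) (f : ℝ → ℝ) :
    ∑ i : Fin n, f (descOrderStat x i) = ∑ i, f (x i) := by
  simp only [descOrderStat_fin]
  exact Equiv.sum_comp (Fin.revPerm.trans (Tuple.sort x)) fun i => f (x i)

theorem descOrderStat_comp {Q : ℝ → ℝ} {s : Set ℝ} (hQ : MonotoneOn Q s) {x : Fin n → ℝ}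
    (hx : ∀ i, x i ∈ s) (i : Fin n) :
    descOrderStat (fun j => Q (x j)) i = Q (descOrderStat x i) := by
  have hsorted : Monotone ((Q ∘ x) ∘ Tuple.sort x) := fun a b hab =>
    hQ (hx _) (hx _) (Tuple.monotone_sort x hab)
  rw [descOrderStat_fin, descOrderStat_fin]
  exact (congrFun (Tuple.comp_sort_eq_comp_iff_monotone.2 hsorted) i.rev).symm

theorem lt_descOrderStat_iff (x : Fin n → ℝ) (i : Fin n) (v : ℝ) :
    v < descOrderStat x i ↔ (i : ℕ) < Fintype.card {j // v < x j} := by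
  have hcard : Fintype.card {j // v < x j} = Fintype.card {j : Fin n // v < descOrderStat x j} := by
    have := sum_descOrderStat x fun y => if v < y then 1 else 0
    simp only [Finset.sum_boole] at this
    rw [Fintype.card_subtype, Fintype.card_subtype]
    exact_mod_cast this.symm
  rw [hcard, Fintype.card_subtype]
  constructor
  · intro hv
    rw [Nat.lt_iff_add_one_le, ← Fin.card_Iic]
    refine Finset.card_le_card fun j hj => ?_
    rw [Finset.mem_filter_univ]
    exact hv.trans_le (antitone_descOrderStat x (Finset.mem_Iic.1 hj))
  · contrapose!
    intro hv
    rw [← Fin.card_Iio]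
    refine Finset.card_le_card fun j hj => ?_
    rw [Finset.mem_filter_univ] at hj
    rw [Finset.mem_Iio]
    by_contra! hij
    exact absurd (antitone_descOrderStat x hij) (hv.trans_lt hj).not_ge

theorem measurable_descOrderStat (n i : ℕ) : Measurable fun x : Fin n → ℝ => descOrderStat x i := by
  by_cases hi : i < n
  · refine measurable_of_Ioi fun v => ?_
    have hpre : (fun x : Fin n → ℝ => descOrderStat x i) ⁻¹' Set.Ioi v =
        (fun x : Fin n → ℝ => ∑ j, if v < x j then 1 else 0) ⁻¹' Set.Ioi i := by
      ext x
      simpa [Fintype.card_subtype] using lt_descOrderStat_iff x ⟨i, hi⟩ v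
    rw [hpre]
    refine measurableSet_Ioi.preimage (Finset.measurable_sum _ fun j _ => ?_)
    exact Measurable.ite (measurableSet_lt measurable_const (measurable_pi_apply j))
      measurable_const measurable_const
  · simp only [descOrderStat, hi, dif_neg, not_false_eq_true, measurable_const]

theorem descOrderStat_comp_perm (x : Fin n → ℝ) (σ : Equiv.Perm (Fin n)) (i : ℕ) :
    descOrderStat (x ∘ σ) i = descOrderStat x i := by
  rcases lt_or_ge i n with hi | hi
  · refine eq_of_forall_lt_iff fun v => ?_
    have hcard : Fintype.card {j // v < (x ∘ σ) j} = Fintype.card {j // v < x j} :=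
      Fintype.card_congr (σ.subtypeEquiv fun _ => Iff.rfl)
    rw [lt_descOrderStat_iff _ ⟨i, hi⟩, lt_descOrderStat_iff _ ⟨i, hi⟩, hcard]
  · simp [descOrderStat, hi.not_gt]

/- For `i = n` both sides are `u`, since then `descOrderStat y i` has the junk value `0`. -/
theorem descOrderStat_snoc_add {y : Fin n → ℝ} (hy : ∀ j, 0 < y j) (u : ℝ) {i : ℕ} (hi : i ≤ n) :
    descOrderStat (Fin.snoc (α := fun _ => ℝ) (fun j => u + y j) u) i = u + descOrderStat y i := by
  have card_snoc (v : ℝ) : Fintype.card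
      {j // v < Fin.snoc (α := fun _ => ℝ) (fun j => u + y j) u j} =
      Fintype.card {j // v - u < y j} + if v < u then 1 else 0 := by
    simp only [Fintype.card_subtype, Finset.card_filter, Fin.sum_univ_castSucc, Fin.snoc_castSucc,
      Fin.snoc_last, sub_lt_iff_lt_add']
  refine eq_of_forall_lt_iff fun v => ?_
  rw [lt_descOrderStat_iff _ ⟨i, by omega⟩, card_snoc, ← sub_lt_iff_lt_add']
  rcases lt_or_ge v u with hv | hv
  · have hall : Fintype.card {j // v - u < y j} = n := by
      rw [Fintype.card_subtype, Finset.filter_true_of_mem, Finset.card_univ, Fintype.card_fin]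
      exact fun j _ => (sub_neg.2 hv).trans (hy j)
    have hpos : v - u < descOrderStat y i := by
      rcases hi.lt_or_eq with hi | rfl
      · rw [lt_descOrderStat_iff _ ⟨i, hi⟩, hall]
        exact hi
      · simpa [descOrderStat] using hv
    simp only [hall, hv, if_true, hpos, iff_true]
    omega
  · rcases hi.lt_or_eq with hi | rfl
    · rw [lt_descOrderStat_iff _ ⟨i, hi⟩]
      simp [hv.not_gt]
    · simpa [descOrderStat, hv.not_gt, hv] using
        (Fintype.card_subtype_le fun j => v - u < y j).trans_eq (Fintype.card_fin i)

end DescOrderStat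

theorem omegaStat_descOrderStat {n m : ℕ} (hmn : m < n) (x : Fin n → ℝ) :
    omegaStat (m + 1) (fun i => descOrderStat x i) = descOrderStat x m +
      zetaGap (m + 1) / m * ∑ j, max (x j - descOrderStat x m) 0 := by
  have hanti {i j : ℕ} (hij : i ≤ j) (hj : j < n) : descOrderStat x j ≤ descOrderStat x i :=
    antitone_descOrderStat x (a := ⟨i, hij.trans_lt hj⟩) (b := ⟨j, hj⟩) hij
  have hexcess : ∑ i ∈ Finset.range m, (descOrderStat x i - descOrderStat x m) =
      ∑ i ∈ Finset.range n, max (descOrderStat x i - descOrderStat x m) 0 := by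
    rw [← Finset.sum_subset (Finset.range_mono hmn.le) fun i hin him => max_eq_right <|
      sub_nonpos.2 (hanti (not_lt.1 fun h => him (Finset.mem_range.2 h)) (Finset.mem_range.1 hin))]
    exact Finset.sum_congr rfl fun i hi =>
      (max_eq_left (sub_nonneg.2 (hanti (Finset.mem_range.1 hi).le hmn))).symm
  rw [omegaStat_succ, ← sum_descOrderStat x fun y => max (y - descOrderStat x m) 0,
    Fin.sum_univ_eq_sum_range fun i => max (descOrderStat x i - descOrderStat x m) 0, ← hexcess]
  simp only [Fin.val_last, Fin.val_castSucc]
  rw [Fin.sum_univ_eq_sum_range fun i => descOrderStat x i - descOrderStat x m]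

section Exponential

instance : IsProbabilityMeasure (expMeasure 1) := isProbabilityMeasure_expMeasure one_pos

theorem expMeasure_one_eq : expMeasure 1 =
    (volume.restrict (Set.Ioi (0 : ℝ))).withDensity fun x => ENNReal.ofReal (Real.exp (-x)) := by
  rw [expMeasure, gammaMeasure, ← withDensity_indicator measurableSet_Ioi]
  refine withDensity_congr_ae ?_
  filter_upwards [Measure.ae_ne volume 0] with x hx
  have h := exponentialPDF_eq 1 x
  rw [exponentialPDF, exponentialPDFReal] at h
  rw [gammaPDF, h]
  rcases lt_or_gt_of_ne hx with h0 | h0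
  · simp [h0.not_ge, h0.le]
  · simp [h0, h0.le]

theorem lintegral_expMeasure_one {f : ℝ → ENNReal} (hf : Measurable f) :
    ∫⁻ x, f x ∂expMeasure 1 =
      ∫⁻ x, (Set.Ioi 0).indicator (fun x => ENNReal.ofReal (Real.exp (-x)) * f x) x := by
  rw [expMeasure_one_eq, lintegral_withDensity_eq_lintegral_mul _ (by fun_prop) hf,
    lintegral_indicator measurableSet_Ioi]
  rfl

theorem ae_expMeasure_pos : ∀ᵐ x ∂expMeasure 1, 0 < x := by
  rw [expMeasure_one_eq]
  exact (withDensity_absolutelyContinuous _ _).ae_le (ae_restrict_mem measurableSet_Ioi)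

theorem lintegral_exp_neg_mul_expMeasure {p : ℝ} (hp : 0 ≤ p) :
    ∫⁻ u, ENNReal.ofReal (Real.exp (-(p * u))) ∂expMeasure 1 = ENNReal.ofReal (1 / (p + 1)) := by
  have hp1 : -(p + 1) < 0 := by linarith
  rw [lintegral_expMeasure_one (by fun_prop), lintegral_indicator measurableSet_Ioi]
  have hint : ∫ u in Set.Ioi (0 : ℝ), Real.exp (-(p + 1) * u) = 1 / (p + 1) := by
    rw [integral_exp_mul_Ioi hp1 0]
    rw [mul_zero, Real.exp_zero, neg_div_neg_eq]
  rw [← hint, ofReal_integral_eq_lintegral_ofReal (integrableOn_exp_mul_Ioi hp1 0)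
    (ae_of_all _ fun _ => (Real.exp_pos _).le)]
  refine lintegral_congr fun u => ?_
  rw [← ENNReal.ofReal_mul (Real.exp_pos _).le, ← Real.exp_add]
  ring_nf

theorem integrable_pow_expMeasure (n : ℕ) : Integrable (fun x => x ^ n) (expMeasure 1) := by
  rw [expMeasure_one_eq, integrable_withDensity_iff (by fun_prop) (by simp)]
  refine (Real.GammaIntegral_convergent (s := n + 1) (by positivity)).congr_fun (fun x _ => ?_)
    measurableSet_Ioi
  simp only [add_sub_cancel_right, Real.rpow_natCast]
  rw [ENNReal.toReal_ofReal (Real.exp_pos _).le, mul_comm]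

theorem integral_pow_expMeasure (n : ℕ) : ∫ x, x ^ n ∂expMeasure 1 = n.factorial := by
  rw [expMeasure_one_eq, integral_withDensity_eq_integral_toReal_smul (by fun_prop) (by simp),
    ← Real.Gamma_nat_eq_factorial, Real.Gamma_eq_integral (by positivity)]
  refine setIntegral_congr_fun measurableSet_Ioi fun x _ => ?_
  simp only [add_sub_cancel_right, Real.rpow_natCast, smul_eq_mul]
  rw [ENNReal.toReal_ofReal (Real.exp_pos _).le]

theorem lintegral_pow_expMeasure (n : ℕ) :
    ∫⁻ x, ENNReal.ofReal (x ^ n) ∂expMeasure 1 = n.factorial := by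
  rw [← ofReal_integral_eq_lintegral_ofReal (integrable_pow_expMeasure n), integral_pow_expMeasure,
    ENNReal.ofReal_natCast]
  filter_upwards [ae_expMeasure_pos] with x hx using pow_nonneg hx.le n

end Exponential

section ExpSample

/-- The law of a sample of `n` independent standard exponential variables. -/
noncomputable abbrev expSample (n : ℕ) : Measure (Fin n → ℝ) :=
  Measure.pi fun _ => expMeasure 1

variable {n : ℕ}

theorem lintegral_pi_snoc (ν : Measure ℝ) [SigmaFinite ν] {f : (Fin (n + 1) → ℝ) → ENNReal}
    (hf : Measurable f) :
    ∫⁻ x, f x ∂Measure.pi (fun _ => ν) =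
      ∫⁻ z, ∫⁻ y, f (Fin.snoc (α := fun _ => ℝ) y z) ∂Measure.pi (fun _ : Fin n => ν) ∂ν := by
  have h := (measurePreserving_piFinSuccAbove (fun _ : Fin (n + 1) => ν) (Fin.last n)).symm
  have hsnoc (p : ℝ × (Fin n → ℝ)) :
      (MeasurableEquiv.piFinSuccAbove (fun _ : Fin (n + 1) => ℝ) (Fin.last n)).symm p =
        Fin.snoc (α := fun _ => ℝ) p.2 p.1 := by
    rw [← Fin.insertNth_last']
    rfl
  rw [← h.lintegral_comp hf]
  refine (lintegral_prod _ (hf.comp (MeasurableEquiv.measurable _)).aemeasurable).trans ?_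
  simp only [Function.comp_apply, hsnoc]

theorem measurable_snoc : Measurable fun p : (Fin n → ℝ) × ℝ =>
    (Fin.snoc p.1 p.2 : Fin (n + 1) → ℝ) := by
  refine measurable_pi_iff.2 fun i => ?_
  induction i using Fin.lastCases with
  | last => simpa only [Fin.snoc_last] using measurable_snd
  | cast i =>
    simp only [Fin.snoc_castSucc]
    exact (measurable_pi_apply i).comp measurable_fst

theorem lintegral_expSample {f : (Fin n → ℝ) → ENNReal} (hf : Measurable f) :
    ∫⁻ x, f x ∂expSample n = ∫⁻ x, (Set.univ.pi fun _ => Set.Ioi 0).indicator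
      (fun x => ENNReal.ofReal (Real.exp (-∑ i, x i)) * f x) x := by
  have hpos (n : ℕ) : MeasurableSet (Set.univ.pi fun _ : Fin n => Set.Ioi (0 : ℝ)) :=
    MeasurableSet.univ_pi fun _ => measurableSet_Ioi
  induction n with
  | zero => simp [lintegral_unique, volume_pi]
  | succ n ih =>
    have hf_snoc : Measurable fun p : (Fin n → ℝ) × ℝ => f (Fin.snoc p.1 p.2) :=
      hf.comp measurable_snoc
    rw [lintegral_pi_snoc _ hf, volume_pi,
      lintegral_pi_snoc _ (Measurable.indicator (by fun_prop) (hpos _)),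
      lintegral_expMeasure_one hf_snoc.lintegral_prod_left', ← volume_pi]
    refine lintegral_congr fun z => ?_
    classical
    have hf_z : Measurable fun y : Fin n → ℝ => f (Fin.snoc y z) :=
      hf_snoc.comp measurable_prodMk_right
    by_cases hz : 0 < z
    · rw [Set.indicator_of_mem (Set.mem_Ioi.2 hz), ih hf_z,
        ← lintegral_const_mul _ (Measurable.indicator (by fun_prop) (hpos _))]
      refine lintegral_congr fun y => ?_
      by_cases hy : ∀ i, 0 < y i
      · simp only [Set.indicator_apply, Set.mem_univ_pi, Set.mem_Ioi, Fin.forall_fin_succ',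
          Fin.snoc_castSucc, Fin.snoc_last, hy, hz, implies_true, and_self, if_true,
          Fin.sum_univ_castSucc]
        rw [← mul_assoc, ← ENNReal.ofReal_mul (Real.exp_pos _).le, ← Real.exp_add]
        ring_nf
      · simp [Fin.forall_fin_succ', hy]
    · simp [Fin.forall_fin_succ', hz]

theorem lintegral_indicator_pi_Ioi (t : ℝ) {f : (Fin n → ℝ) → ENNReal} (hf : Measurable f) :
    ∫⁻ x, (Set.univ.pi fun _ => Set.Ioi t).indicator
        (fun x => ENNReal.ofReal (Real.exp (-∑ i, x i)) * f x) x =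
      ENNReal.ofReal (Real.exp (-(n * t))) * ∫⁻ y, f (fun i => t + y i) ∂expSample n := by
  have hmeas : Measurable fun y : Fin n → ℝ => f fun i => t + y i := by fun_prop
  rw [lintegral_expSample hmeas, ← lintegral_const_mul _
    (Measurable.indicator (by fun_prop) (MeasurableSet.univ_pi fun _ => measurableSet_Ioi)),
    ← lintegral_add_left_eq_self _ (fun _ => t)]
  refine lintegral_congr fun y => ?_
  classical
  by_cases hy : ∀ i, 0 < y i
  · simp only [Set.indicator_apply, Set.mem_univ_pi, Set.mem_Ioi, Pi.add_apply,
      lt_add_iff_pos_right, hy, implies_true, if_true]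
    rw [← mul_assoc, ← ENNReal.ofReal_mul (Real.exp_pos _).le, ← Real.exp_add,
      Finset.sum_add_distrib, Fin.sum_const, nsmul_eq_mul, neg_add]
    rfl
  · simp [hy]

/-- The event that the `i`-th entry is strictly smaller than all the others. -/
def minAt (i : Fin n) : Set (Fin n → ℝ) := {x | ∀ j ≠ i, x i < x j}

theorem measurableSet_minAt (i : Fin n) : MeasurableSet (minAt i) := by
  simp only [minAt, Set.ofPred_forall]
  exact MeasurableSet.iInter fun j => MeasurableSet.iInter fun _ =>
    measurableSet_lt (measurable_pi_apply i) (measurable_pi_apply j)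

theorem setLIntegral_minAt_last_expSample {f : (Fin (n + 1) → ℝ) → ENNReal} (hf : Measurable f) :
    ∫⁻ x in minAt (Fin.last n), f x ∂expSample (n + 1) =
      ∫⁻ u, ENNReal.ofReal (Real.exp (-(n * u))) *
        ∫⁻ y, f (Fin.snoc (fun i => u + y i) u) ∂expSample n ∂expMeasure 1 := by
  have hmeas := (hf.indicator (measurableSet_minAt (Fin.last n))).comp (measurable_snoc (n := n))
  rw [← lintegral_indicator (measurableSet_minAt _),
    lintegral_pi_snoc _ (hf.indicator (measurableSet_minAt _))]
  refine lintegral_congr_ae ?_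
  filter_upwards [ae_expMeasure_pos] with u hu
  rw [← lintegral_indicator_pi_Ioi u (f := fun y => f (Fin.snoc y u))
    ((hf.comp measurable_snoc).comp measurable_prodMk_right)]
  refine (lintegral_expSample (hmeas.comp measurable_prodMk_right)).trans ?_
  refine lintegral_congr fun y => ?_
  by_cases hy : ∀ i, u < y i
  · have hy0 : ∀ i, 0 < y i := fun i => hu.trans (hy i)
    simp [minAt, Set.indicator_apply, Fin.forall_fin_succ', hy, hy0]
  · simp [minAt, Set.indicator_apply, Fin.forall_fin_succ', hy]

theorem ae_injective_expSample : ∀ᵐ x ∂expSample n, Function.Injective x := by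
  have hac : expSample n ≪ volume := by
    refine Measure.AbsolutelyContinuous.mk fun s hs h0 => ?_
    rw [← lintegral_indicator_one hs, lintegral_expSample (measurable_one.indicator hs)]
    refine lintegral_eq_zero_of_ae_eq_zero ?_
    filter_upwards [measure_eq_zero_iff_ae_notMem.1 h0] with x hx
    simp [hx]
  refine hac.ae_le ?_
  have hne (i j : Fin n) : ∀ᵐ x : Fin n → ℝ, x i = x j → i = j := by
    rcases eq_or_ne i j with rfl | hij
    · exact ae_of_all _ fun _ _ => rfl
    let diagonal : Submodule ℝ (Fin n → ℝ) :=
      LinearMap.ker (LinearMap.proj i - LinearMap.proj (R := ℝ) (φ := fun _ => ℝ) j)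
    have htop : diagonal ≠ ⊤ := fun h => by
      have : Pi.single i 1 ∈ diagonal := h ▸ Submodule.mem_top
      simp [diagonal, hij.symm] at this
    have hnull : volume (diagonal : Set (Fin n → ℝ)) = 0 := Measure.addHaar_submodule _ _ htop
    filter_upwards [measure_eq_zero_iff_ae_notMem.1 hnull] with x hx hxij
    exact absurd (by simp [diagonal, hxij]) hx
  filter_upwards [ae_all_iff.2 fun i => ae_all_iff.2 (hne i)] with x hx i j
  exact hx i j

theorem sum_indicator_minAt {x : Fin (n + 1) → ℝ} (hx : Function.Injective x) (c : ENNReal) :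
    ∑ i, (minAt i).indicator (fun _ => c) x = c := by
  obtain ⟨i, hi⟩ := Finite.exists_min x
  have hmem : x ∈ minAt i := fun j hj => (hi j).lt_of_ne (hx.ne hj.symm)
  rw [Finset.sum_eq_single i, Set.indicator_of_mem hmem]
  · exact fun j _ hj => Set.indicator_of_notMem (fun h => (h i hj.symm).not_ge (hi j)) _
  · simp

theorem measurePreserving_comp_perm (σ : Equiv.Perm (Fin n)) :
    MeasurePreserving (fun x : Fin n → ℝ => x ∘ σ) (expSample n) (expSample n) :=
  measurePreserving_arrowCongr' _ _ σ.symm (.refl ℝ) fun _ => .id (expMeasure 1)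

theorem lintegral_expSample_eq_setLIntegral_minAt_last {f : (Fin (n + 1) → ℝ) → ENNReal}
    (hf : Measurable f) (hsymm : ∀ (σ : Equiv.Perm (Fin (n + 1))) x, f (x ∘ σ) = f x) :
    ∫⁻ x, f x ∂expSample (n + 1) =
      (n + 1) * ∫⁻ x in minAt (Fin.last n), f x ∂expSample (n + 1) := by
  have hswap (i : Fin (n + 1)) : ∫⁻ x in minAt i, f x ∂expSample (n + 1) =
      ∫⁻ x in minAt (Fin.last n), f x ∂expSample (n + 1) := by
    rw [← lintegral_indicator (measurableSet_minAt _),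
      ← lintegral_indicator (measurableSet_minAt _),
      ← (measurePreserving_comp_perm (Equiv.swap i (Fin.last n))).lintegral_comp
        (hf.indicator (measurableSet_minAt (Fin.last n)))]
    refine lintegral_congr fun x => ?_
    have hmem : x ∘ Equiv.swap i (Fin.last n) ∈ minAt (Fin.last n) ↔ x ∈ minAt i := by
      simp only [minAt, Set.mem_ofPred_eq, Function.comp_apply, Equiv.swap_apply_right]
      rw [(Equiv.swap i (Fin.last n)).forall_congr_left]
      simp [Equiv.swap_apply_eq_iff]
    classical
    simp only [Set.indicator_apply, hmem, hsymm]
  calc ∫⁻ x, f x ∂expSample (n + 1)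
      = ∫⁻ x, ∑ i, (minAt i).indicator f x ∂expSample (n + 1) := by
        refine lintegral_congr_ae ?_
        filter_upwards [ae_injective_expSample] with x hx
        exact (sum_indicator_minAt hx (f x)).symm
    _ = ∑ _i : Fin (n + 1), ∫⁻ x in minAt (Fin.last n), f x ∂expSample (n + 1) := by
        rw [lintegral_finsetSum _ fun i _ => hf.indicator (measurableSet_minAt i)]
        simp only [lintegral_indicator (measurableSet_minAt _), hswap]
    _ = (n + 1) * ∫⁻ x in minAt (Fin.last n), f x ∂expSample (n + 1) := by
        simp

theorem lintegral_expSample_succ {f : (Fin (n + 1) → ℝ) → ENNReal}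
    (hf : Measurable f) (hsymm : ∀ (σ : Equiv.Perm (Fin (n + 1))) x, f (x ∘ σ) = f x) :
    ∫⁻ x, f x ∂expSample (n + 1) = ∫⁻ u, ENNReal.ofReal ((n + 1) * Real.exp (-(n * u))) *
      ∫⁻ y, f (Fin.snoc (fun i => u + y i) u) ∂expSample n ∂expMeasure 1 := by
  rw [lintegral_expSample_eq_setLIntegral_minAt_last hf hsymm, setLIntegral_minAt_last_expSample hf,
    ← lintegral_const_mul']
  · refine lintegral_congr fun u => ?_
    rw [← mul_assoc, ENNReal.ofReal_mul (by positivity)]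
    congr 2
    norm_cast
  · finiteness

end ExpSample

section Renyi

variable {m n : ℕ}

theorem ae_expSample_pos : ∀ᵐ x ∂expSample n, ∀ i, 0 < x i :=
  ae_all_iff.2 fun i => (Measure.quasiMeasurePreserving_eval _ i).ae ae_expMeasure_pos

theorem descOrderStat_nonneg {x : Fin n → ℝ} (hx : ∀ i, 0 ≤ x i) (m : ℕ) :
    0 ≤ descOrderStat x m := by
  unfold descOrderStat
  split
  · exact hx _
  · exact le_rfl

theorem lintegral_descOrderStat_succ (hmn : m ≤ n) {f : ℝ → ENNReal} (hf : Measurable f) :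
    ∫⁻ x, f (descOrderStat x m) ∂expSample (n + 1) =
      ∫⁻ u, ENNReal.ofReal ((n + 1) * Real.exp (-(n * u))) *
        ∫⁻ y, f (u + descOrderStat y m) ∂expSample n ∂expMeasure 1 := by
  have hstat := measurable_descOrderStat (n + 1) m
  rw [lintegral_expSample_succ (f := fun x => f (descOrderStat x m)) (by fun_prop) fun σ x => by
    rw [descOrderStat_comp_perm]]
  refine lintegral_congr fun u => congrArg _ (lintegral_congr_ae ?_)
  filter_upwards [ae_expSample_pos] with y hy
  rw [descOrderStat_snoc_add hy u hmn]

/- Splitting off the minimum of the sample adds the same constant to the order statistic on both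
sides, and an excess that is not counted. -/
theorem lintegral_descOrderStat_excess (hmn : m ≤ n) {f : ℝ → ℝ → ℝ}
    (hf : Measurable (Function.uncurry f)) (hf0 : ∀ t, f t 0 = 0) {H : ℝ → ℝ → ENNReal}
    (hH : Measurable (Function.uncurry H)) :
    ∫⁻ x, H (descOrderStat x m)
        (∑ j, f (descOrderStat x m) (max (x j - descOrderStat x m) 0)) ∂expSample n =
      ∫⁻ x, ∫⁻ e, H (descOrderStat x m) (∑ i, f (descOrderStat x m) (e i)) ∂expSample m
        ∂expSample n := by
  induction n, hmn using Nat.le_induction generalizing f H with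
  | base =>
    have hjunk (x : Fin m → ℝ) : descOrderStat x m = 0 := by simp [descOrderStat]
    simp only [hjunk, sub_zero, lintegral_const, measure_univ, mul_one]
    refine lintegral_congr_ae ?_
    filter_upwards [ae_expSample_pos] with x hx
    simp only [max_eq_left (hx _).le]
  | succ n hmn ih =>
    have hstat := measurable_descOrderStat (n + 1) m
    have hcond : Measurable fun t => ∫⁻ e, H t (∑ i, f t (e i)) ∂expSample m :=
      Measurable.lintegral_prod_right'
        (f := fun p : ℝ × (Fin m → ℝ) => H p.1 (∑ i, f p.1 (p.2 i))) (by fun_prop)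
    rw [lintegral_descOrderStat_succ hmn hcond, lintegral_expSample_succ (by fun_prop)]
    · refine lintegral_congr fun u => congrArg _ ?_
      rw [← ih (f := fun t => f (u + t)) (H := fun t => H (u + t)) (by fun_prop) (fun _ => hf0 _)
        (by fun_prop)]
      refine lintegral_congr_ae ?_
      filter_upwards [ae_expSample_pos] with y hy
      have hlast : max (u - (u + descOrderStat y m)) 0 = 0 :=
        max_eq_right (by linarith [descOrderStat_nonneg (fun i => (hy i).le) m])
      simp only [descOrderStat_snoc_add hy u hmn, Fin.sum_univ_castSucc, Fin.snoc_castSucc,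
        Fin.snoc_last, hlast, hf0, add_zero, add_sub_add_left_eq_sub]
    · intro σ x
      simp only [descOrderStat_comp_perm, Function.comp_apply]
      rw [Equiv.sum_comp σ fun j => f (descOrderStat x m) (max (x j - descOrderStat x m) 0)]

/- Rényi's representation of the order statistics of an exponential sample. -/
theorem map_descOrderStat_excess (hmn : m ≤ n) {f : ℝ → ℝ → ℝ}
    (hf : Measurable (Function.uncurry f)) (hf0 : ∀ t, f t 0 = 0) :
    (expSample n).map (fun x => (descOrderStat x m,
        ∑ j, f (descOrderStat x m) (max (x j - descOrderStat x m) 0))) =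
      (((expSample n).map fun x => descOrderStat x m).prod (expSample m)).map
        fun p => (p.1, ∑ i, f p.1 (p.2 i)) := by
  have hstat := measurable_descOrderStat n m
  refine Measure.ext_of_lintegral _ fun H hH => ?_
  rw [lintegral_map hH (by fun_prop), lintegral_map hH (by fun_prop),
    lintegral_prod _ (by fun_prop), lintegral_map _ hstat]
  · exact lintegral_descOrderStat_excess hmn hf hf0 (H := fun t s => H (t, s)) hH
  · exact Measurable.lintegral_prod_right'
      (f := fun p : ℝ × (Fin m → ℝ) => H (p.1, ∑ i, f p.1 (p.2 i))) (by fun_prop)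

theorem lintegral_exp_neg_mul_descOrderStat_succ (hmn : m ≤ n) {p : ℝ} (hp : 0 ≤ p) :
    ∫⁻ x, ENNReal.ofReal (Real.exp (-(p * descOrderStat x m))) ∂expSample (n + 1) =
      ENNReal.ofReal ((n + 1) / (n + 1 + p)) *
        ∫⁻ x, ENNReal.ofReal (Real.exp (-(p * descOrderStat x m))) ∂expSample n := by
  have hstat := measurable_descOrderStat n m
  have hn : (0 : ℝ) ≤ n + 1 := by positivity
  have hsplit (u s : ℝ) : ENNReal.ofReal (Real.exp (-(p * (u + s)))) =
      ENNReal.ofReal (Real.exp (-(p * u))) * ENNReal.ofReal (Real.exp (-(p * s))) := by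
    rw [← ENNReal.ofReal_mul (Real.exp_pos _).le, ← Real.exp_add]
    ring_nf
  rw [lintegral_descOrderStat_succ hmn
    (f := fun t => ENNReal.ofReal (Real.exp (-(p * t)))) (by fun_prop)]
  simp_rw [hsplit, lintegral_const_mul _ (f := fun y : Fin n → ℝ =>
    ENNReal.ofReal (Real.exp (-(p * descOrderStat y m)))) (by fun_prop), ← mul_assoc]
  rw [lintegral_mul_const _ (by fun_prop)]
  congr 1
  have hmul (u : ℝ) : ENNReal.ofReal ((n + 1) * Real.exp (-(n * u))) *
      ENNReal.ofReal (Real.exp (-(p * u))) =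
      ENNReal.ofReal (n + 1) * ENNReal.ofReal (Real.exp (-((n + p) * u))) := by
    rw [← ENNReal.ofReal_mul (by positivity), ← ENNReal.ofReal_mul hn, mul_assoc, ← Real.exp_add]
    ring_nf
  simp_rw [hmul]
  rw [lintegral_const_mul _ (by fun_prop), lintegral_exp_neg_mul_expMeasure (by positivity),
    ← ENNReal.ofReal_mul hn]
  congr 1
  ring

theorem lintegral_exp_neg_descOrderStat (hmn : m ≤ n) :
    ∫⁻ x, ENNReal.ofReal (Real.exp (-descOrderStat x m)) ∂expSample n =
      ENNReal.ofReal ((m + 1) / (n + 1)) := by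
  induction n, hmn using Nat.le_induction with
  | base => simp [descOrderStat, div_self (Nat.cast_add_one_ne_zero (R := ℝ) m)]
  | succ n hmn ih =>
    have h := lintegral_exp_neg_mul_descOrderStat_succ hmn zero_le_one
    simp only [one_mul] at h
    rw [h, ih, ← ENNReal.ofReal_mul (by positivity)]
    congr 1
    push_cast
    field_simp

theorem lintegral_exp_neg_descOrderStat_sq (hmn : m ≤ n) :
    ∫⁻ x, ENNReal.ofReal (Real.exp (-descOrderStat x m) ^ 2) ∂expSample n =
      ENNReal.ofReal ((m + 1) * (m + 2) / ((n + 1) * (n + 2))) := by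
  simp only [← Real.exp_nat_mul, Nat.cast_ofNat, mul_neg]
  induction n, hmn using Nat.le_induction with
  | base =>
    have : ((m : ℝ) + 1) * (m + 2) ≠ 0 := by positivity
    simp [descOrderStat, div_self this]
  | succ n hmn ih =>
    rw [lintegral_exp_neg_mul_descOrderStat_succ hmn zero_le_two, ih,
      ← ENNReal.ofReal_mul (by positivity)]
    congr 1
    push_cast
    field_simp
    ring

end Renyi

section GumbelTopLaw

variable {m n : ℕ}

theorem measurableSet_strictAnti : MeasurableSet {x : Fin n → ℝ | StrictAnti x} := by
  simp only [StrictAnti, Set.ofPred_forall]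
  exact MeasurableSet.iInter fun i => MeasurableSet.iInter fun j => MeasurableSet.iInter fun _ =>
    measurableSet_lt (measurable_pi_apply j) (measurable_pi_apply i)

theorem strictAnti_snoc_iff {y : Fin n → ℝ} {u : ℝ} :
    StrictAnti (Fin.snoc (α := fun _ => ℝ) y u) ↔ StrictAnti y ∧ ∀ i, u < y i := by
  simp only [StrictAnti, Fin.forall_fin_succ', Fin.snoc_castSucc, Fin.snoc_last,
    Fin.castSucc_lt_castSucc_iff, Fin.castSucc_lt_last, forall_true_left, lt_irrefl,
    IsEmpty.forall_iff, and_true, (Fin.castSucc_lt_last _).not_gt, implies_true, forall_and]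

theorem exists_perm_snoc_comp (σ : Equiv.Perm (Fin n)) : ∃ τ : Equiv.Perm (Fin (n + 1)),
    ∀ (y : Fin n → ℝ) (u : ℝ), Fin.snoc (α := fun _ => ℝ) (y ∘ σ) u =
      Fin.snoc (α := fun _ => ℝ) y u ∘ τ := by
  refine ⟨finSuccEquivLast.symm.permCongr σ.optionCongr, fun y u => funext fun i => ?_⟩
  induction i using Fin.lastCases with
  | last => simp [Equiv.permCongr_apply]
  | cast i => simp [Equiv.permCongr_apply]

theorem lintegral_indicator_strictAnti_snoc {f : (Fin (n + 1) → ℝ) → ENNReal} (u : ℝ) :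
    ∫⁻ y, {x | StrictAnti x}.indicator f (Fin.snoc (fun i => u + y i) u) ∂expSample n =
      ∫⁻ y in {y | StrictAnti y}, f (Fin.snoc (fun i => u + y i) u) ∂expSample n := by
  rw [← lintegral_indicator measurableSet_strictAnti]
  refine lintegral_congr_ae ?_
  filter_upwards [ae_expSample_pos] with y hy
  classical
  have hshift : StrictAnti (fun i => u + y i) ↔ StrictAnti y := by simp [StrictAnti]
  simp [Set.indicator_apply, strictAnti_snoc_iff, hshift, hy]

theorem setLIntegral_strictAnti_expSample {f : (Fin n → ℝ) → ENNReal} (hf : Measurable f)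
    (hsymm : ∀ (σ : Equiv.Perm (Fin n)) x, f (x ∘ σ) = f x) :
    ∫⁻ x in {x | StrictAnti x}, f x ∂expSample n =
      (n.factorial : ENNReal)⁻¹ * ∫⁻ x, f x ∂expSample n := by
  induction n with
  | zero => simp [Subsingleton.strictAnti]
  | succ n ih =>
    have hsub : {x : Fin (n + 1) → ℝ | StrictAnti x} ⊆ minAt (Fin.last n) :=
      fun x hx j hj => hx (Fin.lt_last_iff_ne_last.2 hj)
    have hinner (u : ℝ) : ∫⁻ y in {y | StrictAnti y}, f (Fin.snoc (fun i => u + y i) u)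
        ∂expSample n = (n.factorial : ENNReal)⁻¹ *
          ∫⁻ y, f (Fin.snoc (fun i => u + y i) u) ∂expSample n := by
      refine ih (hf.comp (measurable_snoc.comp
        (f := fun y : Fin n → ℝ => ((fun i => u + y i), u)) (by fun_prop))) fun σ y => ?_
      obtain ⟨τ, hτ⟩ := exists_perm_snoc_comp σ
      rw [← hsymm τ (Fin.snoc (fun i => u + y i) u), ← hτ]
      rfl
    rw [← Set.inter_eq_self_of_subset_left hsub, ← setLIntegral_indicator measurableSet_strictAnti,
      setLIntegral_minAt_last_expSample (hf.indicator measurableSet_strictAnti),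
      lintegral_expSample_eq_setLIntegral_minAt_last hf hsymm, ← mul_assoc, Nat.factorial_succ,
      Nat.cast_mul, ENNReal.mul_inv (by simp) (by simp), mul_comm, mul_comm _⁻¹, mul_assoc,
      Nat.cast_succ, ENNReal.inv_mul_cancel (by simp) (by simp), mul_one, mul_comm,
      setLIntegral_minAt_last_expSample hf, ← lintegral_const_mul' _ _ (by
        simp [Nat.factorial_ne_zero])]
    refine lintegral_congr fun u => ?_
    rw [lintegral_indicator_strictAnti_snoc, hinner, mul_left_comm]

theorem lintegral_indicator_strictAnti_snoc_volume (t : ℝ) {h : (Fin m → ℝ) → ENNReal}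
    (hh : Measurable h) (hsymm : ∀ (σ : Equiv.Perm (Fin m)) x, h (x ∘ σ) = h x) :
    ∫⁻ y : Fin m → ℝ, {g : Fin (m + 1) → ℝ | StrictAnti g}.indicator
        (fun g => ENNReal.ofReal (Real.exp (-Real.exp (-g (Fin.last m)) - ∑ i, g i)) *
          h fun i => g i.castSucc - g (Fin.last m)) (Fin.snoc y t) =
      (m.factorial : ENNReal)⁻¹ * ENNReal.ofReal (Real.exp (-Real.exp (-t) - (m + 1) * t)) *
        ∫⁻ e, h e ∂expSample m := by
  have hshift : Measurable fun y : Fin m → ℝ => h fun i => y i - t :=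
    hh.comp (by fun_prop)
  have hexp (y : Fin m → ℝ) : ENNReal.ofReal (Real.exp (-Real.exp (-t) - (∑ i, y i + t))) =
      ENNReal.ofReal (Real.exp (-Real.exp (-t) - t)) * ENNReal.ofReal (Real.exp (-∑ i, y i)) := by
    rw [← ENNReal.ofReal_mul (Real.exp_pos _).le, ← Real.exp_add]
    ring_nf
  have hfactor (y : Fin m → ℝ) : {g : Fin (m + 1) → ℝ | StrictAnti g}.indicator
        (fun g => ENNReal.ofReal (Real.exp (-Real.exp (-g (Fin.last m)) - ∑ i, g i)) *
          h fun i => g i.castSucc - g (Fin.last m)) (Fin.snoc y t) =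
      ENNReal.ofReal (Real.exp (-Real.exp (-t) - t)) *
        (Set.univ.pi fun _ => Set.Ioi t).indicator (fun y => ENNReal.ofReal (Real.exp (-∑ i, y i)) *
          {y | StrictAnti y}.indicator (fun y => h fun i => y i - t) y) y := by
    classical
    by_cases hy : StrictAnti y <;> by_cases ht : ∀ i, t < y i <;>
      simp [Set.indicator_apply, strictAnti_snoc_iff, hy, ht, Fin.sum_univ_castSucc, hexp,
        mul_assoc]
  simp_rw [hfactor]
  rw [lintegral_const_mul' _ _ ENNReal.ofReal_ne_top,
    lintegral_indicator_pi_Ioi t (hshift.indicator measurableSet_strictAnti), ← mul_assoc,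
    ← ENNReal.ofReal_mul (Real.exp_pos _).le, ← Real.exp_add, mul_comm _⁻¹, mul_assoc,
    ← setLIntegral_strictAnti_expSample hh hsymm, ← lintegral_indicator measurableSet_strictAnti]
  congr 1
  · ring_nf
  · classical
    refine lintegral_congr fun y => ?_
    have : StrictAnti (fun i => t + y i) ↔ StrictAnti y := by simp [StrictAnti]
    simp [Set.indicator_apply, this]

theorem lintegral_gumbelTopLaw {H : ℝ → ℝ → ENNReal} (hH : Measurable (Function.uncurry H)) :
    ∫⁻ g, H (g (Fin.last m)) (∑ i : Fin m, (g i.castSucc - g (Fin.last m))) ∂gumbelTopLaw (m + 1) =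
      ∫⁻ t, (m.factorial : ENNReal)⁻¹ * ENNReal.ofReal (Real.exp (-Real.exp (-t) - (m + 1) * t)) *
        ∫⁻ e, H t (∑ i, e i) ∂expSample m := by
  have hdensity : Measurable ({g : Fin (m + 1) → ℝ | StrictAnti g}.indicator fun g =>
      ENNReal.ofReal (Real.exp (-Real.exp (-g (Fin.last m)) - ∑ i, g i))) :=
    Measurable.indicator (by fun_prop) measurableSet_strictAnti
  have hintegrand : Measurable fun g : Fin (m + 1) → ℝ =>
      H (g (Fin.last m)) (∑ i : Fin m, (g i.castSucc - g (Fin.last m))) := by fun_prop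
  rw [gumbelTopLaw, lintegral_withDensity_eq_lintegral_mul _ hdensity hintegrand, volume_pi,
    lintegral_pi_snoc _ (hdensity.mul hintegrand)]
  refine lintegral_congr fun t => ?_
  rw [← lintegral_indicator_strictAnti_snoc_volume t (h := fun e => H t (∑ i, e i)) (by fun_prop)
    fun σ x => by simp only [Function.comp_apply, Equiv.sum_comp σ x]]
  refine lintegral_congr fun y => ?_
  classical
  simp [Set.indicator_apply]

theorem map_gumbelTopLaw_excess :
    (gumbelTopLaw (m + 1)).map (fun g =>
        (g (Fin.last m), ∑ i : Fin m, (g i.castSucc - g (Fin.last m)))) =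
      (((gumbelTopLaw (m + 1)).map fun g => g (Fin.last m)).prod (expSample m)).map
        fun p => (p.1, ∑ i, p.2 i) := by
  refine Measure.ext_of_lintegral _ fun H hH => ?_
  have hinner : Measurable fun t => ∫⁻ e : Fin m → ℝ, H (t, ∑ i, e i) ∂expSample m :=
    Measurable.lintegral_prod_right' (f := fun p : ℝ × (Fin m → ℝ) => H (p.1, ∑ i, p.2 i))
      (by fun_prop)
  rw [lintegral_map hH (by fun_prop), lintegral_map hH (by fun_prop),
    lintegral_prod _ (by fun_prop), lintegral_map hinner (by fun_prop),
    lintegral_gumbelTopLaw (H := fun t s => H (t, s)) hH,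
    lintegral_gumbelTopLaw (H := fun t _ => ∫⁻ e, H (t, ∑ i, e i) ∂expSample m)
      (hinner.comp measurable_fst)]
  simp only [lintegral_const, measure_univ, mul_one]

theorem lintegral_comp_exp_neg (f : ℝ → ENNReal) :
    ∫⁻ t : ℝ, ENNReal.ofReal (Real.exp (-t)) * f (Real.exp (-t)) = ∫⁻ w in Set.Ioi 0, f w := by
  have himage : (fun t : ℝ => Real.exp (-t)) '' Set.univ = Set.Ioi 0 := by
    rw [Set.image_univ, ← Real.range_exp]
    exact neg_surjective.range_comp Real.exp
  have hderiv (t : ℝ) : HasDerivAt (fun t : ℝ => Real.exp (-t)) (-Real.exp (-t)) t := by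
    simpa only [mul_neg_one] using (hasDerivAt_neg t).exp
  rw [← himage, lintegral_image_eq_lintegral_abs_deriv_mul MeasurableSet.univ
    (fun t _ => (hderiv t).hasDerivWithinAt)
    (Real.exp_injective.comp neg_injective).injOn, setLIntegral_univ]
  simp only [abs_neg, Real.abs_exp]

theorem lintegral_exp_neg_exp_neg_sub (n : ℕ) :
    ∫⁻ t : ℝ, ENNReal.ofReal (Real.exp (-Real.exp (-t) - (n + 1) * t)) = n.factorial := by
  rw [← lintegral_pow_expMeasure, lintegral_expMeasure_one (by fun_prop),
    lintegral_indicator measurableSet_Ioi, ← lintegral_comp_exp_neg]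
  refine lintegral_congr fun t => ?_
  rw [← ENNReal.ofReal_mul (Real.exp_pos _).le, ← ENNReal.ofReal_mul (Real.exp_pos _).le,
    ← Real.exp_nat_mul, ← Real.exp_add, ← Real.exp_add]
  ring_nf

theorem lintegral_exp_neg_pow_gumbelTopLaw (j : ℕ) :
    ∫⁻ g, ENNReal.ofReal (Real.exp (-g (Fin.last m)) ^ j) ∂gumbelTopLaw (m + 1) =
      (m.factorial : ENNReal)⁻¹ * (m + j).factorial := by
  rw [lintegral_gumbelTopLaw (H := fun t _ => ENNReal.ofReal (Real.exp (-t) ^ j)) (by fun_prop),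
    ← lintegral_exp_neg_exp_neg_sub (m + j), ← lintegral_const_mul _ (by fun_prop)]
  refine lintegral_congr fun t => ?_
  rw [lintegral_const, measure_univ, mul_one, mul_assoc, ← ENNReal.ofReal_mul (Real.exp_pos _).le,
    ← Real.exp_nat_mul, ← Real.exp_add]
  push_cast
  ring_nf

instance : IsProbabilityMeasure (gumbelTopLaw (m + 1)) where
  measure_univ := by
    have h := lintegral_exp_neg_pow_gumbelTopLaw (m := m) 0
    simpa [ENNReal.inv_mul_cancel, Nat.factorial_ne_zero] using h

end GumbelTopLaw

section Chebyshev

variable {Ω : Type*} [MeasurableSpace Ω] {P : Measure Ω} [IsProbabilityMeasure P]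

theorem half_le_abs_exp_neg_sub_one {δ d : ℝ} (hδ1 : δ ≤ 1) (hd : δ < |d|) :
    δ / 2 ≤ |Real.exp (-d) - 1| := by
  rcases le_total δ 0 with hδ0 | hδ0
  · exact (by linarith : δ / 2 ≤ 0).trans (abs_nonneg _)
  have hδ : Real.exp (-δ) ≤ 1 - δ / 2 := by
    have hmul : Real.exp (-δ) * Real.exp δ = 1 := by
      rw [← Real.exp_add, neg_add_cancel, Real.exp_zero]
    nlinarith [Real.add_one_le_exp δ, Real.exp_pos (-δ)]
  rcases lt_abs.1 hd with h | h
  · refine le_abs.2 (Or.inr ?_)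
    linarith [Real.exp_le_exp.2 (neg_le_neg h.le)]
  · exact le_abs.2 (Or.inl (by linarith [Real.add_one_le_exp (-d)]))

theorem measure_lt_abs_add_log_le {T : Ω → ℝ} (hT : Measurable T) {c s : ℝ} (hc : 0 < c)
    (hs : 0 ≤ s) (hfirst : ∫⁻ ω, ENNReal.ofReal (Real.exp (-T ω)) ∂P = ENNReal.ofReal c)
    (hsecond : ∫⁻ ω, ENNReal.ofReal (Real.exp (-T ω) ^ 2) ∂P = ENNReal.ofReal s) {δ : ℝ}
    (hδ0 : 0 < δ) (hδ1 : δ ≤ 1) :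
    P {ω | δ < |T ω + Real.log c|} ≤ ENNReal.ofReal ((s - c ^ 2) / (c * (δ / 2)) ^ 2) := by
  have hmean : P[fun ω => Real.exp (-T ω)] = c := by
    rw [integral_eq_lintegral_of_nonneg_ae (ae_of_all _ fun ω => (Real.exp_pos _).le)
      (by fun_prop), hfirst, ENNReal.toReal_ofReal hc.le]
  have hmean_sq : P[(fun ω => Real.exp (-T ω)) ^ 2] = s := by
    simp only [Pi.pow_apply]
    rw [integral_eq_lintegral_of_nonneg_ae (ae_of_all _ fun ω => sq_nonneg _) (by fun_prop),
      hsecond, ENNReal.toReal_ofReal hs]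
  have hmemLp : MemLp (fun ω => Real.exp (-T ω)) 2 P := by
    refine (memLp_two_iff_integrable_sq (by fun_prop)).2 ⟨by fun_prop, ?_⟩
    rw [hasFiniteIntegral_iff_ofReal (ae_of_all _ fun ω => sq_nonneg _), hsecond]
    exact ENNReal.ofReal_lt_top
  have hcheb := meas_ge_le_variance_div_sq hmemLp (c := c * (δ / 2)) (by positivity)
  rw [variance_eq_sub hmemLp, hmean, hmean_sq] at hcheb
  refine (measure_mono fun ω hω => ?_).trans hcheb
  have hfactor : Real.exp (-T ω) - c = c * (Real.exp (-(T ω + Real.log c)) - 1) := by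
    rw [neg_add, Real.exp_add, Real.exp_neg (Real.log c), Real.exp_log hc]
    field_simp
  rw [Set.mem_ofPred_eq, hfactor, abs_mul, abs_of_pos hc]
  exact mul_le_mul_of_nonneg_left (half_le_abs_exp_neg_sub_one hδ1 hω) hc.le

theorem measure_pi_le_variance_div_sq {μ : Measure ℝ} [IsProbabilityMeasure μ] {g : ℝ → ℝ}
    (hg : MemLp g 2 μ) (m : ℕ) {ε : ℝ} (hε : 0 < ε) :
    Measure.pi (fun _ : Fin m => μ) {e | ε ≤ |(√m)⁻¹ * ∑ i, (g (e i) - ∫ u, g u ∂μ)|} ≤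
      ENNReal.ofReal (Var[g; μ] / ε ^ 2) := by
  rcases Nat.eq_zero_or_pos m with rfl | hm
  · simp [hε.not_ge]
  have hcomp (i : Fin m) : MemLp (fun e : Fin m → ℝ => g (e i)) 2 (Measure.pi fun _ => μ) :=
    hg.comp_measurePreserving (measurePreserving_eval _ i)
  have hmemLp : MemLp (∑ i : Fin m, fun e : Fin m → ℝ => g (e i)) 2 (Measure.pi fun _ => μ) :=
    memLp_finsetSum' _ fun i _ => hcomp i
  have hmean : (Measure.pi fun _ : Fin m => μ)[∑ i : Fin m, fun e : Fin m → ℝ => g (e i)] =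
      ∑ _i : Fin m, ∫ u, g u ∂μ := by
    simp only [Finset.sum_apply]
    rw [integral_finsetSum _ fun i _ => (hcomp i).integrable one_le_two]
    exact Finset.sum_congr rfl fun i _ =>
      integral_comp_eval (μ := fun _ : Fin m => μ) (i := i) hg.aestronglyMeasurable
  have hsqrt : 0 < √(m : ℝ) := Real.sqrt_pos.2 (Nat.cast_pos.2 hm)
  have hcheb := meas_ge_le_variance_div_sq hmemLp (c := √m * ε) (by positivity)
  rw [hmean, variance_sum_pi fun _ => hg] at hcheb
  simp only [Finset.sum_const, Finset.card_univ, Fintype.card_fin, nsmul_eq_mul, mul_pow,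
    Real.sq_sqrt (Nat.cast_nonneg m),
    mul_div_mul_left _ _ (Nat.cast_ne_zero (R := ℝ).2 hm.ne')] at hcheb
  refine (measure_mono fun e he => ?_).trans hcheb
  simp only [Set.mem_ofPred_eq, Finset.sum_sub_distrib, Finset.sum_apply, Finset.sum_const,
    Finset.card_univ, Fintype.card_fin, nsmul_eq_mul, abs_mul, abs_inv, abs_of_pos hsqrt] at he ⊢
  rwa [le_inv_mul_iff₀ hsqrt] at he

end Chebyshev

section BoundedInProbability

/-- The real random variables `X n` are bounded in probability (uniformly tight) as `n → ∞`; they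
may live on different spaces. -/
def IsBoundedInProbability {Ω : ℕ → Type*} [∀ n, MeasurableSpace (Ω n)] (P : ∀ n, Measure (Ω n))
    (X : ∀ n, Ω n → ℝ) : Prop :=
  ∀ ε > 0, ∃ M, ∀ᶠ n in atTop, P n {ω | M < |X n ω|} ≤ ε

theorem isBoundedInProbability_add_log {Ω : ℕ → Type*} [∀ n, MeasurableSpace (Ω n)]
    {P : ∀ n, Measure (Ω n)} [∀ n, IsProbabilityMeasure (P n)] {T : ∀ n, Ω n → ℝ}
    (hT : ∀ n, Measurable (T n)) {m : ℕ → ℕ} (hm : Tendsto m atTop atTop) {c s : ℕ → ℝ}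
    (hc : ∀ n, 0 < c n) (hs : ∀ n, 0 ≤ s n)
    (hfirst : ∀ᶠ n in atTop, ∫⁻ ω, ENNReal.ofReal (Real.exp (-T n ω)) ∂P n =
      ENNReal.ofReal (c n))
    (hsecond : ∀ᶠ n in atTop, ∫⁻ ω, ENNReal.ofReal (Real.exp (-T n ω) ^ 2) ∂P n =
      ENNReal.ofReal (s n))
    (hle : ∀ᶠ n in atTop, m n * (s n - c n ^ 2) ≤ c n ^ 2) :
    IsBoundedInProbability P fun n ω => √(m n) * (T n ω + Real.log (c n)) := by
  intro ε hε
  have hlim : Tendsto (fun M : ℝ => ENNReal.ofReal (4 / M ^ 2)) atTop (𝓝 0) := by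
    rw [← ENNReal.ofReal_zero]
    exact ENNReal.tendsto_ofReal (tendsto_const_nhds.div_atTop (tendsto_pow_atTop two_ne_zero))
  obtain ⟨M, hM0, hMε⟩ := ((eventually_gt_atTop 0).and (hlim.eventually_le_const hε)).exists
  have hsqrt : Tendsto (fun n => √(m n : ℝ)) atTop atTop :=
    Real.tendsto_sqrt_atTop.comp (tendsto_natCast_atTop_atTop.comp hm)
  refine ⟨M, ?_⟩
  filter_upwards [hfirst, hsecond, hle, hsqrt.eventually_ge_atTop M] with n h1 h2 hle hMn
  have hm0 : 0 < √(m n : ℝ) := hM0.trans_le hMn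
  have hsq : √(m n : ℝ) ^ 2 = m n := Real.sq_sqrt (Nat.cast_nonneg _)
  refine le_trans (le_trans ?_ (measure_lt_abs_add_log_le (hT n) (hc n) (hs n) h1 h2
    (div_pos hM0 hm0) ((div_le_one hm0).2 hMn))) (le_trans (ENNReal.ofReal_le_ofReal ?_) hMε)
  · refine measure_mono fun ω hω => ?_
    rwa [Set.mem_ofPred_eq, abs_mul, abs_of_pos hm0, ← div_lt_iff₀' hm0] at hω
  · have hcn := hc n
    rw [div_le_div_iff₀ (by positivity) (by positivity)]
    calc (s n - c n ^ 2) * M ^ 2 = m n * (s n - c n ^ 2) * (M / √(m n)) ^ 2 := by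
          rw [div_pow, hsq]
          field_simp [show (m n : ℝ) ≠ 0 by rw [← hsq]; positivity]
      _ ≤ c n ^ 2 * (M / √(m n)) ^ 2 := by gcongr
      _ = 4 * (c n * (M / √(m n) / 2)) ^ 2 := by ring

end BoundedInProbability

section LocallyLinearIncrements

/-- The unit increment of `Q` at `t`. For `Q s = U (exp s)`, with `U` the tail quantile function,
it is the scale `a (exp t)`. -/
def increment (Q : ℝ → ℝ) (t : ℝ) : ℝ := Q (t + 1) - Q t

/-- Over bounded windows moving to `∞`, the function `Q` is close to linear in the Lipschitz sense,
with slope `increment Q t`, and to the right of such a window it is Lipschitz with a constant of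
the same order. -/
structure HasLocallyLinearIncrements (Q : ℝ → ℝ) : Prop where
  increment_pos : ∀ᶠ t in atTop, 0 < increment Q t
  abs_sub_sub_le : ∀ M, ∀ ε > 0, ∀ᶠ t in atTop, ∀ x ∈ Set.Icc (-M) M, ∀ y ∈ Set.Icc (-M) M,
    |Q (t + x) - Q (t + y) - (x - y) * increment Q t| ≤ ε * |x - y| * increment Q t
  exists_abs_sub_le : ∃ C, ∀ᶠ t in atTop, ∀ x, -1 ≤ x → ∀ y, -1 ≤ y →
    |Q (t + x) - Q (t + y)| ≤ C * |x - y| * increment Q t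

/-- The mean of an exponentially distributed increment of `Q` at `t`. -/
noncomputable def meanExcess (Q : ℝ → ℝ) (t : ℝ) : ℝ :=
  ∫ u, (Q (t + u) - Q t) ∂expMeasure 1

variable {Q : ℝ → ℝ}

namespace HasLocallyLinearIncrements

theorem exists_abs_excess_le (h : HasLocallyLinearIncrements Q) : ∃ C, 0 ≤ C ∧
    ∀ᶠ p : ℝ × ℝ in atTop ×ˢ 𝓝 0, ∀ u, 0 ≤ u →
      |(Q (p.1 + p.2 + u) - Q (p.1 + p.2)) / increment Q p.1| ≤ C * u := by
  obtain ⟨C, hC⟩ := h.exists_abs_sub_le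
  refine ⟨max C 0, le_max_right _ _, ?_⟩
  filter_upwards [(h.increment_pos.and hC).prod_inl _,
    tendsto_snd (Ioi_mem_nhds (neg_one_lt_zero (R := ℝ)))] with p ⟨ha, hp⟩ hd u hu
  have hd : -1 < p.2 := hd
  rw [abs_div, abs_of_pos ha, div_le_iff₀ ha, add_assoc]
  refine (hp _ (by linarith) _ hd.le).trans ?_
  rw [add_sub_cancel_left, abs_of_nonneg hu]
  gcongr
  exact le_max_left _ _

theorem tendsto_excess_div_increment (h : HasLocallyLinearIncrements Q) (u : ℝ) :
    Tendsto (fun p : ℝ × ℝ => (Q (p.1 + p.2 + u) - Q (p.1 + p.2)) / increment Q p.1)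
      (atTop ×ˢ 𝓝 0) (𝓝 u) := by
  refine Metric.tendsto_nhds.2 fun ε hε => ?_
  have hη : 0 < ε / (|u| + 1) := by positivity
  filter_upwards [(h.increment_pos.and (h.abs_sub_sub_le (|u| + 1) _ hη)).prod_inl _,
    tendsto_snd (Icc_mem_nhds (neg_one_lt_zero (R := ℝ)) zero_lt_one)] with p ⟨ha, hp⟩ hd
  have hd : -1 ≤ p.2 ∧ p.2 ≤ 1 := hd
  have hle := hp (p.2 + u) ⟨by linarith [neg_abs_le u], by linarith [le_abs_self u]⟩ p.2
    ⟨by linarith [abs_nonneg u], by linarith [abs_nonneg u]⟩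
  rw [add_sub_cancel_left, ← add_assoc] at hle
  rw [Real.dist_eq, div_sub' ha.ne', abs_div, abs_of_pos ha, div_lt_iff₀ ha, mul_comm _ u]
  refine hle.trans_lt (mul_lt_mul_of_pos_right ?_ ha)
  rw [div_mul_eq_mul_div, div_lt_iff₀ (by positivity)]
  exact mul_lt_mul_of_pos_left (lt_add_one _) hε

theorem tendsto_slope_sub_slope (h : HasLocallyLinearIncrements Q) (u : ℝ) :
    Tendsto (fun p : ℝ × ℝ => ((Q (p.1 + p.2 + u) - Q (p.1 + p.2)) - (Q (p.1 + u) - Q p.1)) /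
      (p.2 * increment Q p.1)) (atTop ×ˢ 𝓝 0) (𝓝 0) := by
  refine Metric.tendsto_nhds.2 fun ε hε => ?_
  have hε3 : 0 < ε / 3 := by positivity
  filter_upwards [(h.increment_pos.and (h.abs_sub_sub_le (|u| + 1) _ hε3)).prod_inl _,
    tendsto_snd (Icc_mem_nhds (neg_one_lt_zero (R := ℝ)) zero_lt_one)] with p ⟨ha, hp⟩ hd
  have hd : -1 ≤ p.2 ∧ p.2 ≤ 1 := hd
  rcases eq_or_ne p.2 0 with h0 | h0
  · simpa [h0] using hε
  have hfar := hp (p.2 + u) ⟨by linarith [neg_abs_le u], by linarith [le_abs_self u]⟩ u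
    ⟨by linarith [neg_abs_le u], by linarith [le_abs_self u]⟩
  have hnear := hp p.2 ⟨by linarith [abs_nonneg u], by linarith [abs_nonneg u]⟩ 0
    ⟨by linarith [abs_nonneg u], by linarith [abs_nonneg u]⟩
  rw [add_sub_cancel_right, ← add_assoc] at hfar
  rw [sub_zero, add_zero] at hnear
  have hpos : 0 < |p.2| * increment Q p.1 := mul_pos (abs_pos.2 h0) ha
  rw [Real.dist_eq, sub_zero, abs_div, abs_mul, abs_of_pos ha, div_lt_iff₀ hpos]
  calc |Q (p.1 + p.2 + u) - Q (p.1 + p.2) - (Q (p.1 + u) - Q p.1)|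
      = |(Q (p.1 + p.2 + u) - Q (p.1 + u) - p.2 * increment Q p.1) -
          (Q (p.1 + p.2) - Q p.1 - p.2 * increment Q p.1)| := by ring_nf
    _ ≤ ε / 3 * |p.2| * increment Q p.1 + ε / 3 * |p.2| * increment Q p.1 :=
        (abs_sub _ _).trans (add_le_add hfar hnear)
    _ < ε * (|p.2| * increment Q p.1) := by nlinarith

theorem eventually_memLp_excess (h : HasLocallyLinearIncrements Q) (hQ : Measurable Q) :
    ∀ᶠ p : ℝ × ℝ in atTop ×ˢ 𝓝 0,
      MemLp (fun u => (Q (p.1 + p.2 + u) - Q (p.1 + p.2)) / increment Q p.1) 2 (expMeasure 1) := by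
  obtain ⟨C, -, hC⟩ := h.exists_abs_excess_le
  filter_upwards [hC] with p hp
  have hid : MemLp (fun u : ℝ => u) 2 (expMeasure 1) :=
    (memLp_two_iff_integrable_sq (by fun_prop)).2 (integrable_pow_expMeasure 2)
  refine (hid.const_mul C).mono (Measurable.aestronglyMeasurable (by fun_prop)) ?_
  filter_upwards [ae_expMeasure_pos] with u hu
  exact (hp u hu.le).trans (le_abs_self _)

theorem tendsto_integral_excess_sub_sq (h : HasLocallyLinearIncrements Q) (hQ : Measurable Q) :
    Tendsto (fun p : ℝ × ℝ =>
        ∫ u, ((Q (p.1 + p.2 + u) - Q (p.1 + p.2)) / increment Q p.1 - u) ^ 2 ∂expMeasure 1)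
      (atTop ×ˢ 𝓝 0) (𝓝 0) := by
  obtain ⟨C, hC0, hC⟩ := h.exists_abs_excess_le
  have hzero : ∫ _ : ℝ, (0 : ℝ) ∂expMeasure 1 = 0 := integral_zero _ _
  nth_rw 2 [← hzero]
  refine tendsto_integral_filter_of_dominated_convergence (fun u => (C + 1) ^ 2 * u ^ 2)
    (Eventually.of_forall fun p => Measurable.aestronglyMeasurable (by fun_prop)) ?_
    ((integrable_pow_expMeasure 2).const_mul _)
    (ae_of_all _ fun u => ?_)
  · filter_upwards [hC] with p hp
    filter_upwards [ae_expMeasure_pos] with u hu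
    rw [Real.norm_eq_abs, abs_sq, ← mul_pow, sq_le_sq,
      abs_of_nonneg (by positivity : 0 ≤ (C + 1) * u)]
    exact (abs_sub _ _).trans (by rw [abs_of_pos hu]; linarith [hp u hu.le])
  · simpa using ((h.tendsto_excess_div_increment u).sub_const u).pow 2

theorem tendsto_meanExcess_div_increment (h : HasLocallyLinearIncrements Q) (hQ : Measurable Q) :
    Tendsto (fun t => meanExcess Q t / increment Q t) atTop (𝓝 1) := by
  obtain ⟨C, -, hC⟩ := h.exists_abs_excess_le
  have hwindow : Tendsto (fun t : ℝ => (t, (0 : ℝ))) atTop (atTop ×ˢ 𝓝 0) :=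
    tendsto_id.prodMk tendsto_const_nhds
  have hone : ∫ u, u ∂expMeasure 1 = 1 := by simpa using integral_pow_expMeasure 1
  rw [← hone]
  simp only [meanExcess, ← integral_div]
  refine tendsto_integral_filter_of_dominated_convergence (fun u => C * u)
    (Eventually.of_forall fun p => Measurable.aestronglyMeasurable (by fun_prop)) ?_
    ((by simpa using integrable_pow_expMeasure 1 : Integrable (fun u => u) _).const_mul C)
    (ae_of_all _ fun u => ?_)
  · filter_upwards [hwindow.eventually hC] with t ht
    filter_upwards [ae_expMeasure_pos] with u hu
    simpa only [add_zero, Real.norm_eq_abs] using ht u hu.le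
  · simpa only [Function.comp_def, add_zero] using
      (h.tendsto_excess_div_increment u).comp hwindow

theorem exists_abs_slope_sub_slope_le (h : HasLocallyLinearIncrements Q) : ∃ C,
    ∀ᶠ p : ℝ × ℝ in atTop ×ˢ 𝓝 0, ∀ u, 0 ≤ u →
      |((Q (p.1 + p.2 + u) - Q (p.1 + p.2)) - (Q (p.1 + u) - Q p.1)) /
        (p.2 * increment Q p.1)| ≤ C := by
  obtain ⟨C, hC⟩ := h.exists_abs_sub_le
  refine ⟨2 * |C|, ?_⟩
  filter_upwards [(h.increment_pos.and hC).prod_inl _,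
    tendsto_snd (Ioi_mem_nhds (neg_one_lt_zero (R := ℝ)))] with p ⟨ha, hp⟩ hd u hu
  have hd : -1 < p.2 := hd
  rcases eq_or_ne p.2 0 with h0 | h0
  · simp [h0]
  have hfar := hp (p.2 + u) (by linarith) u (by linarith)
  have hnear := hp p.2 hd.le 0 (by norm_num)
  rw [add_sub_cancel_right, ← add_assoc] at hfar
  rw [sub_zero, add_zero] at hnear
  have hpos : 0 < |p.2| * increment Q p.1 := mul_pos (abs_pos.2 h0) ha
  rw [abs_div, abs_mul, abs_of_pos ha, div_le_iff₀ hpos, sub_sub_sub_comm]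
  refine (abs_sub _ _).trans ((add_le_add hfar hnear).trans ?_)
  nlinarith [mul_le_mul_of_nonneg_right (le_abs_self C) hpos.le]

theorem tendsto_meanExcess_sub_div (h : HasLocallyLinearIncrements Q) (hQ : Measurable Q) :
    Tendsto (fun p : ℝ × ℝ =>
        (meanExcess Q (p.1 + p.2) - meanExcess Q p.1) / (p.2 * increment Q p.1))
      (atTop ×ˢ 𝓝 0) (𝓝 0) := by
  have hint := h.eventually_memLp_excess hQ
  have hcenter : Tendsto (fun p : ℝ × ℝ => (p.1, (0 : ℝ))) (atTop ×ˢ 𝓝 0) (atTop ×ˢ 𝓝 0) :=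
    tendsto_fst.prodMk tendsto_const_nhds
  have hzero : ∫ _ : ℝ, (0 : ℝ) ∂expMeasure 1 = 0 := integral_zero _ _
  obtain ⟨C, hC⟩ := h.exists_abs_slope_sub_slope_le
  have hslope : Tendsto (fun p : ℝ × ℝ => ∫ u, ((Q (p.1 + p.2 + u) - Q (p.1 + p.2)) -
      (Q (p.1 + u) - Q p.1)) / (p.2 * increment Q p.1) ∂expMeasure 1) (atTop ×ˢ 𝓝 0) (𝓝 0) := by
    nth_rw 2 [← hzero]
    refine tendsto_integral_filter_of_dominated_convergence (fun _ => C)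
      (Eventually.of_forall fun p => Measurable.aestronglyMeasurable (by fun_prop)) ?_
      (integrable_const C) (ae_of_all _ fun u => h.tendsto_slope_sub_slope u)
    filter_upwards [hC] with p hp
    filter_upwards [ae_expMeasure_pos] with u hu using hp u hu.le
  refine hslope.congr' ?_
  filter_upwards [hint, hcenter.eventually hint, h.increment_pos.prod_inl _] with p hp hp0 ha
  have hp := (hp.integrable one_le_two).mul_const (increment Q p.1)
  have hp0 := (hp0.integrable one_le_two).mul_const (increment Q p.1)
  simp only [add_zero, div_mul_cancel₀ _ ha.ne'] at hp hp0
  rw [integral_div, integral_sub hp hp0]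
  rfl

theorem exists_abs_sub_div_increment_le (h : HasLocallyLinearIncrements Q) : ∃ C,
    ∀ᶠ p : ℝ × ℝ in atTop ×ˢ 𝓝 0,
      |(Q (p.1 + p.2) - Q p.1) / increment Q p.1| ≤ |C| * |p.2| := by
  obtain ⟨C, hC⟩ := h.exists_abs_sub_le
  refine ⟨C, ?_⟩
  filter_upwards [(h.increment_pos.and hC).prod_inl _,
    tendsto_snd (Ioi_mem_nhds (neg_one_lt_zero (R := ℝ)))] with p ⟨ha, hp⟩ hd
  have hle := hp p.2 (le_of_lt hd) 0 (by norm_num)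
  rw [sub_zero, add_zero] at hle
  rw [abs_div, abs_of_pos ha, div_le_iff₀ ha]
  exact hle.trans (by gcongr; exact le_abs_self C)

theorem eventually_abs_meanExcess_sub_div_le (h : HasLocallyLinearIncrements Q)
    (hQ : Measurable Q) {ε : ℝ} (hε : 0 < ε) : ∀ᶠ p : ℝ × ℝ in atTop ×ˢ 𝓝 0,
      |(meanExcess Q (p.1 + p.2) - meanExcess Q p.1) / increment Q p.1| ≤ ε * |p.2| := by
  have h0 := (h.tendsto_meanExcess_sub_div hQ).abs
  rw [abs_zero] at h0
  filter_upwards [h0.eventually_le_const hε] with p hp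
  rcases eq_or_ne p.2 0 with hd | hd
  · simp [hd]
  · rw [mul_comm p.2, ← div_div, abs_div _ p.2, div_le_iff₀ (abs_pos.2 hd)] at hp
    exact hp

end HasLocallyLinearIncrements

end LocallyLinearIncrements

section RenyiStat

/-- The form which Rényi's representation gives to `omegaStat (m + 1)`, with `z = zetaGap (m + 1)`:
the values `Q (x + e i)` exceed the threshold `Q x`. -/
noncomputable def renyiStat (Q : ℝ → ℝ) (z : ℝ) {m : ℕ} (x : ℝ) (e : Fin m → ℝ) : ℝ :=
  Q x + z / m * ∑ i, (Q (x + e i) - Q x)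

variable {Q : ℝ → ℝ} {m : ℕ → ℕ} {t z : ℕ → ℝ}

theorem measurable_renyiStat (hQ : Measurable Q) (z : ℝ) (m : ℕ) :
    Measurable fun p : ℝ × (Fin m → ℝ) => renyiStat Q z p.1 p.2 := by
  unfold renyiStat
  fun_prop

theorem eventually_window (hm : Tendsto m atTop atTop) (ht : Tendsto t atTop atTop)
    {r : ℝ × ℝ → Prop} (hr : ∀ᶠ p in atTop ×ˢ 𝓝 0, r p) (M : ℝ) :
    ∀ᶠ n in atTop, ∀ x, √(m n) * |x - t n| ≤ M → r (t n, x - t n) := by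
  obtain ⟨A, hA, B, hB, hAB⟩ := eventually_prod_iff.1 hr
  obtain ⟨δ, hδ, hball⟩ := Metric.eventually_nhds_iff.1 hB
  have hsqrt : Tendsto (fun n => √(m n : ℝ)) atTop atTop :=
    Real.tendsto_sqrt_atTop.comp (tendsto_natCast_atTop_atTop.comp hm)
  filter_upwards [ht.eventually hA, hsqrt.eventually_gt_atTop (M / δ),
    hsqrt.eventually_gt_atTop 0] with n hn hM h0 x hx
  refine hAB hn (hball ?_)
  rw [dist_zero_right, Real.norm_eq_abs]
  rw [div_lt_iff₀ hδ] at hM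
  exact lt_of_mul_lt_mul_left (hx.trans_lt hM) h0.le

/-- The part of the normalized `renyiStat` which depends on the threshold only. -/
noncomputable def thresholdDrift (Q : ℝ → ℝ) (z : ℝ) (m : ℕ) (t x : ℝ) : ℝ :=
  √m / z * ((Q x - Q t) / increment Q t) +
    √m * ((meanExcess Q x - meanExcess Q t) / increment Q t)

theorem eventually_abs_thresholdDrift_le (h : HasLocallyLinearIncrements Q) (hQ : Measurable Q)
    (hm : Tendsto m atTop atTop) (ht : Tendsto t atTop atTop) (hz : Tendsto z atTop atTop) (M : ℝ)
    {ε : ℝ} (hε : 0 < ε) :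
    ∀ᶠ n in atTop, ∀ x, √(m n) * |x - t n| ≤ M → |thresholdDrift Q (z n) (m n) (t n) x| ≤ ε := by
  have hη : 0 < ε / 2 / (|M| + 1) := by positivity
  obtain ⟨C, hC⟩ := h.exists_abs_sub_div_increment_le
  filter_upwards [eventually_window hm ht
    (hC.and (h.eventually_abs_meanExcess_sub_div_le hQ hη)) M, hz.eventually_gt_atTop 0,
    hz.eventually_ge_atTop (|C| * |M| / (ε / 2))] with n hn hz0 hzn x hx
  obtain ⟨h1, h2⟩ := hn x hx
  simp only [add_sub_cancel] at h1 h2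
  have hM : √(m n) * |x - t n| ≤ |M| := hx.trans (le_abs_self M)
  rw [div_le_iff₀ (by positivity)] at hzn
  refine (abs_add_le _ _).trans ((add_le_add (?_ : _ ≤ ε / 2) (?_ : _ ≤ ε / 2)).trans_eq
    (add_halves ε))
  · rw [abs_mul, abs_of_nonneg (by positivity), div_mul_eq_mul_div, div_le_iff₀ hz0]
    calc √(m n) * |(Q x - Q (t n)) / increment Q (t n)| ≤ √(m n) * (|C| * |x - t n|) := by gcongr
      _ = |C| * (√(m n) * |x - t n|) := by ring
      _ ≤ |C| * |M| := by gcongr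
      _ ≤ ε / 2 * z n := by linarith
  · rw [abs_mul, abs_of_nonneg (Real.sqrt_nonneg _)]
    calc √(m n) * |(meanExcess Q x - meanExcess Q (t n)) / increment Q (t n)|
        ≤ √(m n) * (ε / 2 / (|M| + 1) * |x - t n|) := by gcongr
      _ = ε / 2 * (√(m n) * |x - t n| / (|M| + 1)) := by ring
      _ ≤ ε / 2 * 1 := by
          gcongr
          exact (div_le_one (by positivity)).2 (by linarith)
      _ = ε / 2 := mul_one _

theorem normalized_renyiStat_eq {Q : ℝ → ℝ} {m : ℕ} {t z : ℝ} (hm : m ≠ 0) (hz : z ≠ 0)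
    (ha : increment Q t ≠ 0) (x : ℝ) (e : Fin m → ℝ) :
    (renyiStat Q z x e - (Q t + z * meanExcess Q t)) / (increment Q t * (z / √m)) -
        (√m)⁻¹ * ∑ i, (e i - 1) =
      thresholdDrift Q z m t x +
        (√m)⁻¹ * ∑ i, (((Q (x + e i) - Q x) / increment Q t - e i) -
          (meanExcess Q x / increment Q t - 1)) := by
  have hm0 : (0 : ℝ) < m := by positivity
  obtain ⟨s, hs, hms⟩ : ∃ s : ℝ, 0 < s ∧ (m : ℝ) = s ^ 2 :=
    ⟨√m, Real.sqrt_pos.2 hm0, (Real.sq_sqrt hm0.le).symm⟩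
  simp only [renyiStat, thresholdDrift, Finset.sum_sub_distrib, ← Finset.sum_div, Finset.sum_const,
    Finset.card_univ, Fintype.card_fin, nsmul_eq_mul, hms, Real.sqrt_sq hs.le]
  field_simp
  ring

end RenyiStat

section ExcessError

/-- The error made when an excess of `Q` over `Q x`, measured in units of `increment Q t`, is
replaced by its argument. -/
noncomputable def excessError (Q : ℝ → ℝ) (t x u : ℝ) : ℝ :=
  (Q (x + u) - Q x) / increment Q t - u

variable {Q : ℝ → ℝ}

theorem integral_excessError {t x : ℝ} (h : MemLp (excessError Q t x) 2 (expMeasure 1)) :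
    ∫ u, excessError Q t x u ∂expMeasure 1 = meanExcess Q x / increment Q t - 1 := by
  have hid : Integrable (fun u : ℝ => u) (expMeasure 1) := by
    simpa using integrable_pow_expMeasure 1
  have hquot : Integrable (fun u => (Q (x + u) - Q x) / increment Q t) (expMeasure 1) :=
    ((h.integrable one_le_two).add hid).congr (ae_of_all _ fun u => by simp [excessError])
  have hone : ∫ u, u ∂expMeasure 1 = 1 := by simpa using integral_pow_expMeasure 1
  simp only [excessError]
  rw [integral_sub hquot hid, integral_div, hone, meanExcess]

namespace HasLocallyLinearIncrements

theorem eventually_memLp_excessError (h : HasLocallyLinearIncrements Q) (hQ : Measurable Q) :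
    ∀ᶠ p : ℝ × ℝ in atTop ×ˢ 𝓝 0, MemLp (excessError Q p.1 (p.1 + p.2)) 2 (expMeasure 1) :=
  (h.eventually_memLp_excess hQ).mono fun _ hp =>
    hp.sub ((memLp_two_iff_integrable_sq (by fun_prop)).2 (integrable_pow_expMeasure 2))

theorem eventually_variance_excessError_le (h : HasLocallyLinearIncrements Q) (hQ : Measurable Q)
    {η : ℝ} (hη : 0 < η) :
    ∀ᶠ p : ℝ × ℝ in atTop ×ˢ 𝓝 0, Var[excessError Q p.1 (p.1 + p.2); expMeasure 1] ≤ η := by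
  filter_upwards [h.eventually_memLp_excessError hQ,
    (h.tendsto_integral_excess_sub_sq hQ).eventually_le_const hη] with p hmem hp
  exact (variance_le_expectation_sq hmem.aestronglyMeasurable).trans hp

end HasLocallyLinearIncrements

end ExcessError

section NormalApproximation

theorem prod_apply_le_add {α β : Type*} [MeasurableSpace α] [MeasurableSpace β] {ν : Measure α}
    [IsProbabilityMeasure ν] {κ : Measure β} [IsProbabilityMeasure κ] {s : Set (α × β)}
    (hs : MeasurableSet s) {A : Set α} (hA : MeasurableSet A) {c : ENNReal}
    (hle : ∀ x ∉ A, κ (Prod.mk x ⁻¹' s) ≤ c) : ν.prod κ s ≤ ν A + c := by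
  classical
  calc ν.prod κ s = ∫⁻ x, κ (Prod.mk x ⁻¹' s) ∂ν := Measure.prod_apply hs
    _ ≤ ∫⁻ x, (A.indicator 1 x + c) ∂ν := by
        refine lintegral_mono fun x => ?_
        by_cases hx : x ∈ A
        · simpa [hx] using prob_le_one.trans le_self_add
        · simpa [hx] using hle x hx
    _ = ν A + c := by
        rw [lintegral_add_left (measurable_one.indicator hA), lintegral_indicator_one hA,
          lintegral_const, measure_univ, mul_one]

variable {Q : ℝ → ℝ} {m : ℕ → ℕ} {t z : ℕ → ℝ} {ν : ℕ → Measure ℝ}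
  [∀ n, IsProbabilityMeasure (ν n)]

/-- The difference between the normalized `renyiStat` and the normalized sum of the excesses. -/
noncomputable def renyiRemainder (Q : ℝ → ℝ) (z : ℝ) (m : ℕ) (t : ℝ) (p : ℝ × (Fin m → ℝ)) : ℝ :=
  (renyiStat Q z p.1 p.2 - (Q t + z * meanExcess Q t)) / (increment Q t * (z / √m)) -
    (√m)⁻¹ * ∑ i, (p.2 i - 1)

theorem measurable_renyiRemainder (hQ : Measurable Q) (z : ℝ) (m : ℕ) (t : ℝ) :
    Measurable (renyiRemainder Q z m t) :=
  (((measurable_renyiStat hQ z m).sub_const _).div_const _).sub (by fun_prop)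

theorem eventually_measure_pi_renyiRemainder_le (h : HasLocallyLinearIncrements Q)
    (hQ : Measurable Q) (hm : Tendsto m atTop atTop) (ht : Tendsto t atTop atTop)
    (hz : Tendsto z atTop atTop) (M : ℝ) {ε η : ℝ} (hε : 0 < ε) (hη : 0 < η) :
    ∀ᶠ n in atTop, ∀ x, √(m n) * |x - t n| ≤ M → expSample (m n)
      {e | ε ≤ |renyiRemainder Q (z n) (m n) (t n) (x, e)|} ≤ ENNReal.ofReal η := by
  have hvar := (h.eventually_memLp_excessError hQ).and
    (h.eventually_variance_excessError_le hQ (η := η * (ε / 2) ^ 2) (by positivity))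
  filter_upwards [eventually_window hm ht hvar M,
    eventually_abs_thresholdDrift_le h hQ hm ht hz M (half_pos hε), hm.eventually_ne_atTop 0,
    hz.eventually_ne_atTop 0, ht.eventually h.increment_pos] with n hvar hdrift hm0 hz0 ha x hx
  obtain ⟨hmem, hvar⟩ := hvar x hx
  rw [add_sub_cancel] at hmem hvar
  have hcheb := measure_pi_le_variance_div_sq hmem (m n) (half_pos hε)
  rw [integral_excessError hmem] at hcheb
  refine (measure_mono fun e he => ?_).trans (hcheb.trans (ENNReal.ofReal_le_ofReal ?_))
  · rw [Set.mem_ofPred_eq, renyiRemainder, normalized_renyiStat_eq hm0 hz0 ha.ne'] at he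
    simp only [Set.mem_ofPred_eq, excessError]
    linarith [he.trans (abs_add_le _ _), hdrift x hx]
  · exact (div_le_iff₀ (by positivity)).2 hvar

theorem tendsto_measure_renyiRemainder (h : HasLocallyLinearIncrements Q)
    (hQ : Measurable Q) (hm : Tendsto m atTop atTop) (ht : Tendsto t atTop atTop)
    (hz : Tendsto z atTop atTop)
    (htight : IsBoundedInProbability ν fun n x => √(m n) * (x - t n)) {ε : ℝ} (hε : 0 < ε) :
    Tendsto (fun n => ((ν n).prod (expSample (m n)))
      {p | ε ≤ |renyiRemainder Q (z n) (m n) (t n) p|}) atTop (𝓝 0) := by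
  refine ENNReal.tendsto_nhds_zero.2 fun η hη => ?_
  obtain ⟨r, hr0, hr⟩ := ENNReal.lt_iff_exists_nnreal_btwn.1 (ENNReal.half_pos hη.ne')
  obtain ⟨M, hM⟩ := htight _ (ENNReal.half_pos hη.ne')
  filter_upwards [hM, eventually_measure_pi_renyiRemainder_le h hQ hm ht hz M hε
    (NNReal.coe_pos.2 (ENNReal.coe_pos.1 hr0))] with n hMn hn
  have hmeas := measurable_renyiRemainder hQ (z n) (m n) (t n)
  calc ((ν n).prod (expSample (m n))) {p | ε ≤ |renyiRemainder Q (z n) (m n) (t n) p|}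
      ≤ ν n {x | M < |√(m n) * (x - t n)|} + r := by
        refine prod_apply_le_add (measurableSet_le measurable_const (by fun_prop))
          (measurableSet_lt measurable_const (by fun_prop)) fun x hx => ?_
        rw [Set.mem_ofPred_eq, not_lt, abs_mul, abs_of_nonneg (Real.sqrt_nonneg _)] at hx
        simpa using hn x hx
    _ ≤ η / 2 + η / 2 := add_le_add hMn hr.le
    _ = η := ENNReal.add_halves η

end NormalApproximation

section CentralLimit

theorem tendstoInDistribution_of_eventually_map_eq {E ι Ω₀ : Type*} [TopologicalSpace E]
    [MeasurableSpace E] [OpensMeasurableSpace E] [MeasurableSpace Ω₀] {Ω Ω' : ι → Type*}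
    [∀ i, MeasurableSpace (Ω i)] [∀ i, MeasurableSpace (Ω' i)] {P : ∀ i, Measure (Ω i)}
    [∀ i, IsProbabilityMeasure (P i)] {P' : ∀ i, Measure (Ω' i)}
    [∀ i, IsProbabilityMeasure (P' i)] {P₀ : Measure Ω₀} [IsProbabilityMeasure P₀] {l : Filter ι}
    {X : ∀ i, Ω i → E} {X' : ∀ i, Ω' i → E} {Z : Ω₀ → E} (h : TendstoInDistribution X l Z P P₀)
    (hX' : ∀ i, AEMeasurable (X' i) (P' i))
    (heq : ∀ᶠ i in l, (P' i).map (X' i) = (P i).map (X i)) :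
    TendstoInDistribution X' l Z P' P₀ := by
  refine ⟨hX', h.aemeasurable_limit, h.tendsto.congr' ?_⟩
  filter_upwards [heq] with i hi
  exact Subtype.ext hi.symm

theorem tendstoInDistribution_affine {Ω Ω₀ : Type*} [MeasurableSpace Ω] [MeasurableSpace Ω₀]
    {P : Measure Ω} [IsProbabilityMeasure P] {P₀ : Measure Ω₀} [IsProbabilityMeasure P₀]
    {X : ℕ → Ω → ℝ} {Z : Ω₀ → ℝ} (h : TendstoInDistribution X atTop Z (fun _ => P) P₀)
    {r s : ℕ → ℝ} (hr : Tendsto r atTop (𝓝 1)) (hs : Tendsto s atTop (𝓝 0)) :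
    TendstoInDistribution (fun n ω => r n * X n ω + s n) atTop Z (fun _ => P) P₀ := by
  have hrs : TendstoInMeasure P (fun n (_ : Ω) => (r n, s n)) atTop fun _ => ((1 : ℝ), (0 : ℝ)) :=
    tendstoInMeasure_of_tendsto_ae (fun n => aestronglyMeasurable_const)
      (Eventually.of_forall fun _ => hr.prodMk_nhds hs)
  simpa only [one_mul, add_zero] using h.continuous_comp_prodMk_of_tendstoInMeasure_const
    (g := fun p : ℝ × (ℝ × ℝ) => p.2.1 * p.1 + p.2.2) (by fun_prop) hrs
    (fun n => aemeasurable_const)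

theorem integral_sub_one_expMeasure : ∫ u, (u - 1) ∂expMeasure 1 = 0 := by
  have hone : ∫ u, u ∂expMeasure 1 = 1 := by simpa using integral_pow_expMeasure 1
  rw [integral_sub (by simpa using integrable_pow_expMeasure 1) (integrable_const 1), hone]
  simp

theorem integral_sub_one_sq_expMeasure : ∫ u, (u - 1) ^ 2 ∂expMeasure 1 = 1 := by
  have hsplit (u : ℝ) : (u - 1) ^ 2 = u ^ 2 - 1 - 2 * (u - 1) := by ring
  have htwo : ∫ u, u ^ 2 ∂expMeasure 1 = 2 := by simpa using integral_pow_expMeasure 2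
  have hsq : Integrable (fun u : ℝ => u ^ 2 - 1) (expMeasure 1) :=
    (integrable_pow_expMeasure 2).sub (integrable_const 1)
  have hlin : Integrable (fun u : ℝ => 2 * (u - 1)) (expMeasure 1) :=
    Integrable.const_mul
      (.sub (by simpa using integrable_pow_expMeasure 1) (integrable_const 1)) 2
  simp only [hsplit]
  rw [integral_sub hsq hlin, integral_const_mul, integral_sub_one_expMeasure,
    integral_sub (integrable_pow_expMeasure 2) (integrable_const 1), htwo]
  norm_num

/-- The joint law of independent thresholds with laws `ν n` and of an infinite sequence of
exponential excesses: a single space, for all `n`, on which the central limit theorem applies. -/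
noncomputable abbrev renyiSpace (ν : ℕ → Measure ℝ) : Measure ((ℕ → ℝ) × (ℕ → ℝ)) :=
  (Measure.infinitePi ν).prod (Measure.infinitePi fun _ : ℕ => expMeasure 1)

variable {ν : ℕ → Measure ℝ} [∀ n, IsProbabilityMeasure (ν n)]

theorem measurePreserving_renyiSpace (n m : ℕ) :
    MeasurePreserving (fun ω : (ℕ → ℝ) × (ℕ → ℝ) => (ω.1 n, fun i : Fin m => ω.2 i))
      (renyiSpace ν) ((ν n).prod (expSample m)) := by
  have hmap : (Measure.infinitePi fun _ : ℕ => expMeasure 1).map (fun e (i : Fin m) => e i) =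
      expSample m := by
    rw [Measure.map_infinitePi_infinitePi_of_inj Fin.val_injective, Measure.infinitePi_eq_pi]
  exact (measurePreserving_eval_infinitePi ν n).prod ⟨by fun_prop, hmap⟩

theorem tendstoInDistribution_sum_renyiSpace {m : ℕ → ℕ} (hm : Tendsto m atTop atTop) :
    TendstoInDistribution (fun n (ω : (ℕ → ℝ) × (ℕ → ℝ)) =>
        (√(m n))⁻¹ * ∑ i : Fin (m n), (ω.2 i - 1)) atTop id (fun _ => renyiSpace ν)
      (gaussianReal 0 1) := by
  have hlaw (i : ℕ) : HasLaw (fun ω : (ℕ → ℝ) × (ℕ → ℝ) => ω.2 i) (expMeasure 1)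
      (renyiSpace ν) := by
    have hpres := (measurePreserving_eval_infinitePi (fun _ : ℕ => expMeasure 1) i).comp
      (measurePreserving_snd (μ := Measure.infinitePi ν))
    exact ⟨hpres.aemeasurable, hpres.map_eq⟩
  have hindep : iIndepFun (fun i (ω : (ℕ → ℝ) × (ℕ → ℝ)) => ω.2 i) (renyiSpace ν) := by
    rw [iIndepFun_iff_map_fun_eq_infinitePi_map fun i => by fun_prop]
    simp only [fun i => (hlaw i).map_eq]
    exact Measure.snd_prod
  have hclt := tendstoInDistribution_inv_sqrt_mul_sum (P := renyiSpace ν)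
    (X := fun i (ω : (ℕ → ℝ) × (ℕ → ℝ)) => ω.2 i - 1) (HasLaw.id (μ := gaussianReal 0 1))
    (((hlaw 0).integral_comp (f := fun u => u - 1) (by fun_prop)).trans
      integral_sub_one_expMeasure)
    (((hlaw 0).integral_comp (f := fun u => (u - 1) ^ 2) (by fun_prop)).trans
      integral_sub_one_sq_expMeasure)
    (hindep.comp (fun _ u => u - 1) fun _ => by fun_prop)
    fun i => ((hlaw i).identDistrib (hlaw 0)).comp (u := fun u => u - 1) (by fun_prop)
  simp only [← Fin.sum_univ_eq_sum_range] at hclt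
  exact ⟨fun n => hclt.forall_aemeasurable (m n), hclt.aemeasurable_limit, hclt.tendsto.comp hm⟩

theorem tendstoInDistribution_of_map_eq_renyiStat {Ω : ℕ → Type*} [∀ n, MeasurableSpace (Ω n)]
    {P : ∀ n, Measure (Ω n)} [∀ n, IsProbabilityMeasure (P n)] {X : ∀ n, Ω n → ℝ} {Q : ℝ → ℝ}
    {m : ℕ → ℕ} {t z : ℕ → ℝ} (h : HasLocallyLinearIncrements Q) (hQ : Measurable Q)
    (hm : Tendsto m atTop atTop) (ht : Tendsto t atTop atTop) (hz : Tendsto z atTop atTop)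
    (htight : IsBoundedInProbability ν fun n x => √(m n) * (x - t n))
    (hX : ∀ n, AEMeasurable (X n) (P n))
    (hlaw : ∀ᶠ n in atTop, (P n).map (X n) =
      ((ν n).prod (expSample (m n))).map fun p => renyiStat Q (z n) p.1 p.2) :
    TendstoInDistribution (fun n ω => (X n ω - (Q (t n) + z n * meanExcess Q (t n))) /
        (increment Q (t n) * (z n / √(m n)))) atTop id P (gaussianReal 0 1) := by
  have hpres (n : ℕ) := measurePreserving_renyiSpace (ν := ν) n (m n)
  have hstat (n : ℕ) := measurable_renyiStat hQ (z n) (m n)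
  have happrox : TendstoInMeasure (renyiSpace ν)
      (fun n ω => renyiRemainder Q (z n) (m n) (t n) (ω.1 n, fun i => ω.2 i)) atTop 0 := by
    refine tendstoInMeasure_iff_norm.2 fun ε hε => ?_
    refine (tendsto_measure_renyiRemainder h hQ hm ht hz htight hε).congr fun n => ?_
    rw [← (hpres n).measure_preimage (measurableSet_le measurable_const
      (measurable_renyiRemainder hQ (z n) (m n) (t n)).abs).nullMeasurableSet]
    simp
  have hmeas (n : ℕ) : Measurable fun ω : (ℕ → ℝ) × (ℕ → ℝ) =>
      renyiStat Q (z n) (ω.1 n) fun i : Fin (m n) => ω.2 i :=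
    (hstat n).comp (hpres n).measurable
  have hlimit := tendstoInDistribution_of_tendstoInMeasure_sub
    (Y := fun n (ω : (ℕ → ℝ) × (ℕ → ℝ)) =>
      (renyiStat Q (z n) (ω.1 n) (fun i : Fin (m n) => ω.2 i) -
        (Q (t n) + z n * meanExcess Q (t n))) / (increment Q (t n) * (z n / √(m n)))) id
    (tendstoInDistribution_sum_renyiSpace (ν := ν) hm) happrox
    fun n => (((hmeas n).sub_const _).div_const _).aemeasurable
  refine tendstoInDistribution_of_eventually_map_eq hlimit
    (fun n => ((hX n).sub_const _).div_const _) ?_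
  filter_upwards [hlaw] with n hn
  have hident : IdentDistrib (X n) (fun ω : (ℕ → ℝ) × (ℕ → ℝ) =>
      renyiStat Q (z n) (ω.1 n) fun i : Fin (m n) => ω.2 i) (P n) (renyiSpace ν) := by
    refine ⟨hX n, (hmeas n).aemeasurable, ?_⟩
    rw [hn, ← (hpres n).map_eq, Measure.map_map (hstat n) (hpres n).measurable]
    rfl
  exact ((hident.sub_const _).div_const _).map_eq

end CentralLimit

section ZetaGap

theorem abs_zetaGap_succ_sub_log_le {m : ℕ} (hm : m ≠ 0) :
    |zetaGap (m + 1) - Real.log (m + 1)| ≤ 1 / m := by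
  have hm0 : (0 : ℝ) < m := by positivity
  have hlower := Real.eulerMascheroniSeq_lt_eulerMascheroniConstant m
  have hupper := Real.eulerMascheroniConstant_lt_eulerMascheroniSeq' m
  rw [Real.eulerMascheroniSeq] at hlower
  rw [Real.eulerMascheroniSeq', if_neg hm] at hupper
  have hlog : Real.log (m + 1) - Real.log m ≤ 1 / m := by
    rw [← Real.log_div (by positivity) hm0.ne']
    refine (Real.log_le_sub_one_of_pos (by positivity)).trans_eq ?_
    rw [add_div, div_self hm0.ne', add_sub_cancel_left]
  rw [zetaGap, Nat.add_sub_cancel, abs_le]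
  constructor <;> linarith [one_div_pos.2 hm0]

theorem tendsto_sqrt_mul_zetaGap_succ_sub_log :
    Tendsto (fun m : ℕ => √m * (zetaGap (m + 1) - Real.log (m + 1))) atTop (𝓝 0) := by
  have hlim : Tendsto (fun m : ℕ => (√(m : ℝ))⁻¹) atTop (𝓝 0) :=
    (Real.tendsto_sqrt_atTop.comp tendsto_natCast_atTop_atTop).inv_tendsto_atTop
  refine squeeze_zero_norm' ?_ hlim
  filter_upwards [eventually_ne_atTop 0] with m hm
  rw [norm_mul, Real.norm_eq_abs, Real.norm_eq_abs, abs_of_nonneg (Real.sqrt_nonneg _),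
    ← Real.sqrt_div_self, div_eq_mul_one_div]
  exact mul_le_mul_of_nonneg_left (abs_zetaGap_succ_sub_log_le hm) (Real.sqrt_nonneg _)

theorem tendsto_zetaGap_succ : Tendsto (fun m : ℕ => zetaGap (m + 1)) atTop atTop := by
  have hlog : Tendsto (fun m : ℕ => Real.log (m + 1) - 1) atTop atTop :=
    tendsto_atTop_add_const_right _ _ (Real.tendsto_log_atTop.comp
      (tendsto_atTop_add_const_right _ 1 tendsto_natCast_atTop_atTop))
  refine tendsto_atTop_mono' _ ?_ hlog
  filter_upwards [eventually_ne_atTop 0] with m hm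
  have hone : 1 / (m : ℝ) ≤ 1 :=
    div_le_one_of_le₀ (Nat.one_le_cast.2 (Nat.one_le_iff_ne_zero.2 hm)) (Nat.cast_nonneg m)
  linarith [neg_abs_le (zetaGap (m + 1) - Real.log (m + 1)), abs_zetaGap_succ_sub_log_le hm]

theorem omegaScale_succ (m : ℕ) : omegaScale (m + 1) = zetaGap (m + 1) / √m := by
  rw [omegaScale, Nat.cast_add_one, add_sub_cancel_right]

end ZetaGap

namespace IsBoundedInProbability

variable {Ω : ℕ → Type*} [∀ n, MeasurableSpace (Ω n)] {P : ∀ n, Measure (Ω n)}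

theorem add_const {X : ∀ n, Ω n → ℝ} (h : IsBoundedInProbability P X) {s : ℕ → ℝ}
    (hs : Tendsto s atTop (𝓝 0)) : IsBoundedInProbability P fun n ω => X n ω + s n := by
  intro ε hε
  obtain ⟨M, hM⟩ := h ε hε
  have habs := hs.abs
  rw [abs_zero] at habs
  refine ⟨M + 1, ?_⟩
  filter_upwards [hM, habs.eventually_le_const one_pos] with n hMn hsn
  refine (measure_mono fun ω hω => ?_).trans hMn
  rw [Set.mem_ofPred_eq] at hω ⊢
  linarith [hω.trans_le (abs_add_le _ _)]

theorem map {T : ∀ n, Ω n → ℝ} (hT : ∀ n, Measurable (T n)) {f : ℕ → ℝ → ℝ}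
    (hf : ∀ n, Measurable (f n)) (h : IsBoundedInProbability P fun n ω => f n (T n ω)) :
    IsBoundedInProbability (fun n => (P n).map (T n)) f := by
  intro ε hε
  obtain ⟨M, hM⟩ := h ε hε
  refine ⟨M, hM.mono fun n hn => ?_⟩
  rwa [Measure.map_apply (hT n) (measurableSet_lt measurable_const (hf n).abs)]

end IsBoundedInProbability

section Gumbel

theorem increment_id (t : ℝ) : increment id t = 1 := add_sub_cancel_left t 1

theorem hasLocallyLinearIncrements_id : HasLocallyLinearIncrements id where
  increment_pos := Eventually.of_forall fun t => by rw [increment_id]; exact one_pos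
  abs_sub_sub_le M ε hε := Eventually.of_forall fun t x _ y _ => by
    rw [increment_id, id, id, show t + x - (t + y) - (x - y) * 1 = 0 by ring, abs_zero]
    positivity
  exists_abs_sub_le := ⟨1, Eventually.of_forall fun t x _ y _ => by
    rw [increment_id, id, id, add_sub_add_left_eq_sub, one_mul, mul_one]⟩

theorem meanExcess_id (t : ℝ) : meanExcess id t = 1 := by
  simpa [meanExcess] using integral_pow_expMeasure 1

theorem isBoundedInProbability_gumbelTopLaw_last :
    IsBoundedInProbability (fun m => gumbelTopLaw (m + 1))
      fun m g => √m * (g (Fin.last m) + zetaGap (m + 1)) := by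
  have hratio (m j : ℕ) : (m.factorial : ENNReal)⁻¹ * (m + j).factorial =
      ENNReal.ofReal ((m + 1).ascFactorial j) := by
    have hne : (m.factorial : ENNReal) ≠ 0 := Nat.cast_ne_zero.2 m.factorial_ne_zero
    rw [← Nat.factorial_mul_ascFactorial, Nat.cast_mul, ENNReal.ofReal_natCast,
      ENNReal.inv_mul_cancel_left hne (ENNReal.natCast_ne_top _)]
  have hbdd := isBoundedInProbability_add_log (P := fun m => gumbelTopLaw (m + 1))
    (T := fun m g => g (Fin.last m)) (fun m => by fun_prop) (m := fun m => m) tendsto_id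
    (c := fun m => m + 1) (s := fun m => (m + 1) * (m + 2))
    (fun m => by positivity) (fun m => by positivity)
    (Eventually.of_forall fun m => ?_) (Eventually.of_forall fun m => ?_)
    (Eventually.of_forall fun m => by nlinarith)
  · convert hbdd.add_const tendsto_sqrt_mul_zetaGap_succ_sub_log using 3 with m g
    ring
  · have hfirst := (lintegral_exp_neg_pow_gumbelTopLaw (m := m) 1).trans (hratio m 1)
    simp only [pow_one] at hfirst
    rw [hfirst, Nat.ascFactorial_succ, Nat.ascFactorial_zero, mul_one, add_zero, Nat.cast_add_one]
  · rw [lintegral_exp_neg_pow_gumbelTopLaw, hratio, Nat.ascFactorial_succ, Nat.ascFactorial_succ,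
      Nat.ascFactorial_zero]
    push_cast
    ring_nf

theorem map_omegaStat_gumbelTopLaw (m : ℕ) (s : ℝ) :
    (gumbelTopLaw (m + 1)).map (fun g => omegaStat (m + 1) g + s) =
      (((gumbelTopLaw (m + 1)).map fun g => g (Fin.last m) + s).prod (expSample m)).map
        fun p => renyiStat id (zetaGap (m + 1)) p.1 p.2 := by
  have hlast : Measurable fun g : Fin (m + 1) → ℝ => g (Fin.last m) := by fun_prop
  have hshift : ((gumbelTopLaw (m + 1)).map fun g => g (Fin.last m) + s).prod (expSample m) =
      (((gumbelTopLaw (m + 1)).map fun g => g (Fin.last m)).prod (expSample m)).map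
        fun p => (p.1 + s, p.2) := by
    have := Measure.isProbabilityMeasure_map (μ := gumbelTopLaw (m + 1)) hlast.aemeasurable
    have hprod := Measure.map_prod_map ((gumbelTopLaw (m + 1)).map fun g => g (Fin.last m))
      (expSample m) (measurable_add_const s) measurable_id
    rwa [Measure.map_map (measurable_add_const s) hlast, Measure.map_id] at hprod
  have hcomb : Measurable fun p : ℝ × ℝ => p.1 + zetaGap (m + 1) / m * p.2 + s := by fun_prop
  have hexcess := congrArg (Measure.map fun p : ℝ × ℝ => p.1 + zetaGap (m + 1) / m * p.2 + s)
    (map_gumbelTopLaw_excess (m := m))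
  rw [Measure.map_map hcomb (by fun_prop), Measure.map_map hcomb (by fun_prop)] at hexcess
  rw [hshift, Measure.map_map (measurable_renyiStat measurable_id _ _) (by fun_prop)]
  convert hexcess using 2
  · funext g
    simp only [omegaStat_succ, Function.comp]
  · funext p
    simp only [renyiStat, id_eq, add_sub_cancel_left, Function.comp_apply]
    ring

theorem tendstoInDistribution_omegaStat_gumbelTopLaw {Ω : ℕ → Type*} [∀ k, MeasurableSpace (Ω k)]
    (P : ∀ k, Measure (Ω k)) [∀ k, IsProbabilityMeasure (P k)] (G : ∀ k, Ω k → Fin k → ℝ)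
    (hG : ∀ k, HasLaw (G k) (gumbelTopLaw k) (P k)) :
    TendstoInDistribution (fun k ω => omegaStat k (G k ω) / omegaScale k) atTop id P
      (gaussianReal 0 1) := by
  have hmeas (k : ℕ) : AEMeasurable (fun ω => omegaStat k (G k ω)) (P k) :=
    (measurable_omegaStat k).comp_aemeasurable (hG k).aemeasurable
  have hlast (m : ℕ) : Measurable fun g : Fin (m + 1) → ℝ =>
    g (Fin.last m) + 2 * zetaGap (m + 1) := by fun_prop
  have hprob (m : ℕ) := Measure.isProbabilityMeasure_map (μ := gumbelTopLaw (m + 1))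
    (hlast m).aemeasurable
  have htight : IsBoundedInProbability (fun m => (gumbelTopLaw (m + 1)).map fun g =>
      g (Fin.last m) + 2 * zetaGap (m + 1)) fun m x => √m * (x - zetaGap (m + 1)) := by
    refine IsBoundedInProbability.map hlast (fun m => by fun_prop) ?_
    convert isBoundedInProbability_gumbelTopLaw_last using 4
    ring
  have hlimit := tendstoInDistribution_of_map_eq_renyiStat (P := fun m => P (m + 1))
    (X := fun m ω => omegaStat (m + 1) (G (m + 1) ω) + 2 * zetaGap (m + 1))
    hasLocallyLinearIncrements_id measurable_id (m := fun m => m) tendsto_id tendsto_zetaGap_succ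
    tendsto_zetaGap_succ htight (fun m => (hmeas (m + 1)).add_const _)
    (Eventually.of_forall fun m => ?_)
  · have hcenter (m : ℕ) (x : ℝ) :
        (x + 2 * zetaGap (m + 1) - (id (zetaGap (m + 1)) + zetaGap (m + 1) *
          meanExcess id (zetaGap (m + 1)))) / (increment id (zetaGap (m + 1)) *
          (zetaGap (m + 1) / √m)) = x / omegaScale (m + 1) := by
      rw [meanExcess_id, increment_id, omegaScale_succ, id, one_mul]
      ring
    simp only [hcenter] at hlimit
    exact ⟨fun k => (hmeas k).div_const _, aemeasurable_id,
      (tendsto_add_atTop_iff_nat 1).1 hlimit.tendsto⟩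
  · rw [← map_omegaStat_gumbelTopLaw, ← (hG (m + 1)).map_eq,
      AEMeasurable.map_map_of_aemeasurable (((measurable_omegaStat (m + 1)).add_const
        (2 * zetaGap (m + 1))).aemeasurable) (hG (m + 1)).aemeasurable]
    rfl

end Gumbel

section Quantile

variable {μ : Measure ℝ}

theorem quantile_le_iff {p : ℝ} (hp0 : 0 < p) (hp1 : p < 1) (x : ℝ) :
    quantile μ p ≤ x ↔ p ≤ cdf μ x := by
  have hne : {y | p ≤ cdf μ y}.Nonempty := by
    obtain ⟨y, hy⟩ := ((tendsto_cdf_atTop μ).eventually_const_lt hp1).exists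
    exact ⟨y, hy.le⟩
  have hbdd : BddBelow {y | p ≤ cdf μ y} := by
    obtain ⟨y, hy⟩ := ((tendsto_cdf_atBot μ).eventually_lt_const hp0).exists
    exact ⟨y, fun z hz => ((monotone_cdf μ).reflect_lt (hy.trans_le hz)).le⟩
  refine ⟨fun hx => ?_, fun hx => csInf_le hbdd hx⟩
  have hright : ∀ᶠ y in 𝓝[>] x, p ≤ cdf μ y := by
    filter_upwards [self_mem_nhdsWithin] with y hy
    obtain ⟨z, hz, hzy⟩ := exists_lt_of_csInf_lt hne (hx.trans_lt hy)
    exact (Set.mem_ofPred.1 hz).trans (monotone_cdf μ hzy.le)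
  exact ge_of_tendsto (((cdf μ).right_continuous x).mono Set.Ioi_subset_Ici_self) hright

/-- The tail quantile function in the logarithmic scale, `s ↦ U(e^s)`. It transports the standard
exponential law to `μ`, and its increments over unit intervals are the values of `gumbelScale`. -/
noncomputable def logQuantile (μ : Measure ℝ) (s : ℝ) : ℝ :=
  tailQuantile μ (Real.exp s)

theorem logQuantile_log {y : ℝ} (hy : 0 < y) : logQuantile μ (Real.log y) = tailQuantile μ y := by
  rw [logQuantile, Real.exp_log hy]

theorem increment_logQuantile_log {y : ℝ} (hy : 0 < y) :
    increment (logQuantile μ) (Real.log y) = gumbelScale μ y := by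
  rw [increment, gumbelScale, logQuantile, Real.exp_add, Real.exp_log hy, logQuantile_log hy,
    mul_comm]

theorem logQuantile_eq_quantile (s : ℝ) : logQuantile μ s = quantile μ (1 - Real.exp (-s)) := by
  rw [logQuantile, tailQuantile, Real.exp_neg, one_div]

theorem logQuantile_le_iff {s : ℝ} (hs : 0 < s) (x : ℝ) :
    logQuantile μ s ≤ x ↔ 1 - Real.exp (-s) ≤ cdf μ x := by
  rw [logQuantile_eq_quantile]
  exact quantile_le_iff (sub_pos.2 (Real.exp_lt_one_iff.2 (neg_neg_iff_pos.2 hs)))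
    (sub_lt_self 1 (Real.exp_pos _)) x

theorem monotoneOn_logQuantile : MonotoneOn (logQuantile μ) (Set.Ioi 0) := by
  intro s hs t ht hst
  refine (logQuantile_le_iff hs _).2 (le_trans ?_ ((logQuantile_le_iff ht _).1 le_rfl))
  gcongr

theorem logQuantile_of_nonpos {s : ℝ} (hs : s ≤ 0) : logQuantile μ s = 0 := by
  have huniv : {x | 1 - Real.exp (-s) ≤ cdf μ x} = Set.univ := Set.eq_univ_of_forall fun x =>
    (sub_nonpos.2 (Real.one_le_exp (neg_nonneg.2 hs))).trans (cdf_nonneg μ x)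
  rw [logQuantile_eq_quantile, quantile, huniv, Real.sInf_univ]

theorem measurable_logQuantile : Measurable (logQuantile μ) := by
  refine measurable_of_Iic fun x => ?_
  have hset : logQuantile μ ⁻¹' Set.Iic x =
      Set.ite (Set.Ioi 0) {s | 1 - Real.exp (-s) ≤ cdf μ x} {_s | 0 ≤ x} := by
    ext s
    rcases lt_or_ge 0 s with hs | hs
    · simpa [Set.ite, hs] using logQuantile_le_iff hs x
    · simp [Set.ite, hs, logQuantile_of_nonpos]
  rw [hset]
  exact measurableSet_Ioi.ite (measurableSet_le (by fun_prop) (by fun_prop)) (.const _)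

theorem map_logQuantile_expMeasure [IsProbabilityMeasure μ] :
    (expMeasure 1).map (logQuantile μ) = μ := by
  have := Measure.isProbabilityMeasure_map (μ := expMeasure 1)
    (measurable_logQuantile (μ := μ)).aemeasurable
  refine Measure.ext_of_Iic _ _ fun x => ?_
  have hae : logQuantile μ ⁻¹' Set.Iic x =ᵐ[expMeasure 1] {s | 1 - Real.exp (-s) ≤ cdf μ x} := by
    filter_upwards [ae_expMeasure_pos] with s hs using propext (logQuantile_le_iff hs x)
  rw [Measure.map_apply measurable_logQuantile measurableSet_Iic, measure_congr hae, ← ofReal_cdf]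
  rcases (cdf_le_one μ x).eq_or_lt with hone | hlt
  · have huniv : {s | 1 - Real.exp (-s) ≤ cdf μ x} = Set.univ := Set.eq_univ_of_forall fun s => by
      rw [Set.mem_ofPred_eq, hone]
      exact sub_le_self 1 (Real.exp_pos _).le
    rw [huniv, hone, measure_univ, ENNReal.ofReal_one]
  · have htail : 0 < 1 - cdf μ x := sub_pos.2 hlt
    have hIic : {s | 1 - Real.exp (-s) ≤ cdf μ x} = Set.Iic (-Real.log (1 - cdf μ x)) := by
      ext s
      rw [Set.mem_ofPred_eq, Set.mem_Iic, sub_le_comm, ← Real.log_le_iff_le_exp htail, le_neg]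
    rw [hIic, ← ofReal_cdf, cdf_expMeasure_eq one_pos, if_pos, one_mul, neg_neg,
      Real.exp_log htail, sub_sub_cancel]
    exact neg_nonneg.2 (Real.log_nonpos htail.le (sub_le_self 1 (cdf_nonneg μ x)))

end Quantile

section Sample

variable {n m : ℕ} {Q : ℝ → ℝ}

theorem omegaStat_descOrderStat_comp {s : Set ℝ} (hQ : MonotoneOn Q s) (hmn : m < n)
    {x : Fin n → ℝ} (hx : ∀ i, x i ∈ s) :
    omegaStat (m + 1) (fun i => descOrderStat (fun j => Q (x j)) i) =
      Q (descOrderStat x m) + zetaGap (m + 1) / m *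
        ∑ j, (Q (descOrderStat x m + max (x j - descOrderStat x m) 0) - Q (descOrderStat x m)) := by
  rw [omegaStat_descOrderStat hmn, descOrderStat_comp hQ hx ⟨m, hmn⟩]
  have hmem : descOrderStat x m ∈ s := by
    rw [descOrderStat_fin x ⟨m, hmn⟩]
    exact hx _
  congr 2
  refine Finset.sum_congr rfl fun j _ => ?_
  rcases le_total (x j) (descOrderStat x m) with hj | hj
  · rw [max_eq_right (sub_nonpos.2 (hQ (hx j) hmem hj)), max_eq_right (sub_nonpos.2 hj), add_zero,
      sub_self]
  · rw [max_eq_left (sub_nonneg.2 (hQ hmem (hx j) hj)), max_eq_left (sub_nonneg.2 hj),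
      add_sub_cancel]

theorem map_omegaStat_comp_expSample (hQ : Measurable Q) (hmono : MonotoneOn Q (Set.Ioi 0))
    (hmn : m < n) :
    (expSample n).map (fun x => omegaStat (m + 1) fun i => descOrderStat (fun j => Q (x j)) i) =
      (((expSample n).map fun x => descOrderStat x m).prod (expSample m)).map
        fun p => renyiStat Q (zetaGap (m + 1)) p.1 p.2 := by
  have hcomb : Measurable fun p : ℝ × ℝ => Q p.1 + zetaGap (m + 1) / m * p.2 := by fun_prop
  have hexcess := congrArg (Measure.map fun p : ℝ × ℝ => Q p.1 + zetaGap (m + 1) / m * p.2)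
    (map_descOrderStat_excess (f := fun t e => Q (t + e) - Q t) hmn.le (by fun_prop)
      fun t => by rw [add_zero, sub_self])
  have hstat := measurable_descOrderStat n m
  rw [Measure.map_map hcomb (by fun_prop), Measure.map_map hcomb (by fun_prop)] at hexcess
  refine (Measure.map_congr ?_).trans hexcess
  filter_upwards [ae_expSample_pos] with x hx using omegaStat_descOrderStat_comp hmono hmn hx

theorem map_omegaSample {Ω : Type*} [MeasurableSpace Ω] {P : Measure Ω} [IsProbabilityMeasure P]
    {Y : ℕ → Ω → ℝ} {μ : Measure ℝ} [IsProbabilityMeasure μ] (hlaw : ∀ i, HasLaw (Y i) μ P)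
    (hindep : iIndepFun Y P) (n k : ℕ) :
    P.map (omegaSample Y n k) = (expSample n).map fun x =>
      omegaStat k fun i => descOrderStat (fun j => logQuantile μ (x j)) i := by
  have hY (i : ℕ) : AEMeasurable (Y i) P := (hlaw i).aemeasurable
  have hstat : Measurable fun x : Fin n → ℝ => omegaStat k fun i => descOrderStat x i :=
    (measurable_omegaStat k).comp (measurable_pi_lambda _ fun i => measurable_descOrderStat n i)
  have hjoint : P.map (fun ω (j : Fin n) => Y j ω) =
      (expSample n).map fun x j => logQuantile μ (x j) := by
    rw [(iIndepFun_iff_map_fun_eq_pi_map fun j : Fin n => hY j).1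
      (hindep.precomp Fin.val_injective), Measure.pi_map_pi fun _ =>
      measurable_logQuantile.aemeasurable]
    simp only [(hlaw _).map_eq, map_logQuantile_expMeasure]
  have hquantile : Measurable fun (x : Fin n → ℝ) j => logQuantile μ (x j) :=
    measurable_pi_lambda _ fun j => measurable_logQuantile.comp (measurable_pi_apply j)
  have hcomp := congrArg (Measure.map fun x : Fin n → ℝ => omegaStat k fun i => descOrderStat x i)
    hjoint
  rwa [AEMeasurable.map_map_of_aemeasurable hstat.aemeasurable (by fun_prop), Measure.map_map hstat
    hquantile] at hcomp

end Sample

section Intermediate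

variable {k : ℕ → ℕ}

theorem eventually_lt_of_tendsto_div (hkn : Tendsto (fun n => (k n : ℝ) / n) atTop (𝓝 0)) :
    ∀ᶠ n in atTop, k n < n := by
  filter_upwards [hkn.eventually_lt_const one_pos, eventually_gt_atTop 0] with n hlt hn
  exact_mod_cast (div_lt_one (Nat.cast_pos.2 hn)).1 hlt

theorem tendsto_log_div_atTop (hk : Tendsto k atTop atTop)
    (hkn : Tendsto (fun n => (k n : ℝ) / n) atTop (𝓝 0)) :
    Tendsto (fun n => Real.log (n / k n)) atTop atTop := by
  have hpos : ∀ᶠ n in atTop, (k n : ℝ) / n ∈ Set.Ioi 0 := by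
    filter_upwards [hk.eventually_gt_atTop 0, eventually_gt_atTop 0] with n hkn hn
    rw [Set.mem_Ioi]
    positivity
  refine Real.tendsto_log_atTop.comp ?_
  simpa only [Function.comp_def, inv_div] using
    tendsto_inv_nhdsGT_zero.comp (tendsto_nhdsWithin_iff.2 ⟨hkn, hpos⟩)

theorem tendsto_sqrt_mul_log_div (hk : Tendsto k atTop atTop)
    (hkn : Tendsto (fun n => (k n : ℝ) / n) atTop (𝓝 0)) :
    Tendsto (fun n => √(k n - 1 : ℕ) *
      (-Real.log (n / k n) - Real.log (((k n - 1 : ℕ) + 1) / (n + 1)))) atTop (𝓝 0) := by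
  have hlog : ∀ᶠ n : ℕ in atTop,
      -Real.log (n / k n) - Real.log (((k n - 1 : ℕ) + 1) / (n + 1)) = Real.log (1 + 1 / n) := by
    filter_upwards [hk.eventually_gt_atTop 0, eventually_gt_atTop 0] with n hk0 hn
    have : (0 : ℝ) < k n := Nat.cast_pos.2 hk0
    have : (0 : ℝ) < n := Nat.cast_pos.2 hn
    rw [Nat.cast_pred hk0, sub_add_cancel, ← Real.log_inv, ← Real.log_div (by positivity)
      (by positivity)]
    congr 1
    field_simp
  have hlog_nonneg (n : ℕ) : 0 ≤ Real.log (1 + 1 / n) := Real.log_nonneg (by simp)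
  refine squeeze_zero' (hlog.mono fun n hn => ?_) ?_ hkn
  · rw [hn]
    exact mul_nonneg (Real.sqrt_nonneg _) (hlog_nonneg n)
  filter_upwards [hlog] with n hn
  have hsqrt : √(k n - 1 : ℕ) ≤ k n := by
    refine Real.sqrt_le_iff.2 ⟨Nat.cast_nonneg _, ?_⟩
    exact_mod_cast (Nat.sub_le _ _).trans (Nat.le_self_pow two_ne_zero _)
  have hle : Real.log (1 + 1 / n) ≤ 1 / n :=
    (Real.log_le_sub_one_of_pos (by positivity)).trans_eq (add_sub_cancel_left _ _)
  rw [hn, div_eq_mul_one_div (k n : ℝ)]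
  exact mul_le_mul hsqrt hle (hlog_nonneg n) (Nat.cast_nonneg _)

theorem isBoundedInProbability_descOrderStat (hk : Tendsto k atTop atTop)
    (hkn : Tendsto (fun n => (k n : ℝ) / n) atTop (𝓝 0)) :
    IsBoundedInProbability (fun n => expSample n) fun n x =>
      √(k n - 1 : ℕ) * (descOrderStat x (k n - 1) - Real.log (n / k n)) := by
  have hle : ∀ᶠ n in atTop, k n - 1 ≤ n :=
    (eventually_lt_of_tendsto_div hkn).mono fun n hn => (Nat.sub_le _ _).trans hn.le
  have hbdd := isBoundedInProbability_add_log (P := fun n => expSample n)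
    (T := fun n x => descOrderStat x (k n - 1)) (fun n => measurable_descOrderStat n _)
    (m := fun n => k n - 1) ((tendsto_sub_atTop_nat 1).comp hk)
    (c := fun n => ((k n - 1 : ℕ) + 1) / (n + 1))
    (s := fun n => ((k n - 1 : ℕ) + 1) * ((k n - 1 : ℕ) + 2) / ((n + 1) * (n + 2)))
    (fun n => by positivity) (fun n => by positivity)
    (hle.mono fun n hn => lintegral_exp_neg_descOrderStat hn)
    (hle.mono fun n hn => lintegral_exp_neg_descOrderStat_sq hn)
    (Eventually.of_forall fun n => ?_)
  · convert hbdd.add_const (tendsto_sqrt_mul_log_div hk hkn) using 3 with n x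
    ring
  · have hm : (0 : ℝ) ≤ (k n - 1 : ℕ) := Nat.cast_nonneg _
    set m : ℝ := ((k n - 1 : ℕ) : ℝ)
    have hsquare : m * (m + 2) ≤ (m + 1) ^ 2 := by linarith [sq (m + 1)]
    have hsum : m * ((m + 1) * (m + 2) / ((n + 1) * (n + 2))) ≤
        (m + 1) * ((m + 1) / (n + 1)) ^ 2 := by
      calc m * ((m + 1) * (m + 2) / ((n + 1) * (n + 2)))
          = (m + 1) * (m * (m + 2) / ((n + 1) * (n + 2))) := by ring
        _ ≤ (m + 1) * ((m + 1) ^ 2 / ((n + 1) * (n + 1))) := by gcongr; norm_num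
        _ = (m + 1) * ((m + 1) / (n + 1)) ^ 2 := by rw [div_pow, sq ((n : ℝ) + 1)]
    linarith

end Intermediate

section Sample

theorem aemeasurable_omegaSample {Ω : Type*} [MeasurableSpace Ω] {P : Measure Ω} {Y : ℕ → Ω → ℝ}
    (hY : ∀ i, AEMeasurable (Y i) P) (n k : ℕ) : AEMeasurable (omegaSample Y n k) P :=
  ((measurable_omegaStat k).comp (measurable_pi_lambda _ fun i =>
    measurable_descOrderStat n i)).comp_aemeasurable (by fun_prop)

variable {Ω : Type*} [MeasurableSpace Ω] {P : Measure Ω} [IsProbabilityMeasure P]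
  {Y : ℕ → Ω → ℝ} {μ : Measure ℝ} {k : ℕ → ℕ}

/-- The natural centring of `omegaSample Y n k`: the value of the stochastic representation of
`omegaSample` when the threshold is replaced by `U(n/k)` and the mean of the excesses over it by
their expectation. -/
noncomputable def omegaCenter (μ : Measure ℝ) (n k : ℕ) : ℝ :=
  tailQuantile μ (n / k) + zetaGap k * meanExcess (logQuantile μ) (Real.log (n / k))

theorem tendstoInDistribution_omegaSample [IsProbabilityMeasure μ]
    (h : HasLocallyLinearIncrements (logQuantile μ)) (hlaw : ∀ i, HasLaw (Y i) μ P)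
    (hindep : iIndepFun Y P) (hk : Tendsto k atTop atTop)
    (hkn : Tendsto (fun n => (k n : ℝ) / n) atTop (𝓝 0)) :
    TendstoInDistribution (fun n ω => (omegaSample Y n (k n) ω - omegaCenter μ n (k n)) /
      (gumbelScale μ (n / k n) * omegaScale (k n))) atTop id (fun _ => P) (gaussianReal 0 1) := by
  have hY (i : ℕ) : AEMeasurable (Y i) P := (hlaw i).aemeasurable
  have hm : Tendsto (fun n => k n - 1) atTop atTop := (tendsto_sub_atTop_nat 1).comp hk
  have hstat (n : ℕ) := measurable_descOrderStat n (k n - 1)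
  have hprob (n : ℕ) := Measure.isProbabilityMeasure_map (μ := expSample n) (hstat n).aemeasurable
  have hpos : ∀ᶠ n in atTop, 0 < k n ∧ 0 < n :=
    (hk.eventually_gt_atTop 0).and (eventually_gt_atTop 0)
  have htight := IsBoundedInProbability.map hstat (fun n => by fun_prop)
    (f := fun n x => √(k n - 1 : ℕ) * (x - Real.log (n / k n)))
    (isBoundedInProbability_descOrderStat hk hkn)
  have hlimit := tendstoInDistribution_of_map_eq_renyiStat (P := fun _ => P)
    (X := fun n => omegaSample Y n (k n)) h measurable_logQuantile hm
    (tendsto_log_div_atTop hk hkn) (tendsto_zetaGap_succ.comp hm) htight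
    (fun n => aemeasurable_omegaSample hY n (k n)) ?_
  · refine tendstoInDistribution_of_eventually_map_eq hlimit (fun n =>
      ((aemeasurable_omegaSample hY n (k n)).sub_const _).div_const _) ?_
    filter_upwards [hpos] with n ⟨hk0, hn⟩
    have hquot : (0 : ℝ) < n / k n := div_pos (Nat.cast_pos.2 hn) (Nat.cast_pos.2 hk0)
    rw [omegaCenter, increment_logQuantile_log hquot, logQuantile_log hquot, omegaScale,
      Function.comp, Nat.sub_add_cancel hk0, Nat.cast_pred hk0]
  · filter_upwards [hpos, eventually_lt_of_tendsto_div hkn] with n ⟨hk0, _⟩ hlt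
    have hmap := map_omegaStat_comp_expSample (m := k n - 1) (measurable_logQuantile (μ := μ))
      monotoneOn_logQuantile ((k n).sub_le 1 |>.trans_lt hlt)
    rw [Nat.sub_add_cancel hk0] at hmap
    rw [map_omegaSample hlaw hindep, hmap, Function.comp, Nat.sub_add_cancel hk0]

end Sample

theorem exists_tendsto_atTop_eventually {p : ℕ → ℕ → Prop} (hp : ∀ m, ∀ᶠ n in atTop, p m n) :
    ∃ κ : ℕ → ℕ, Tendsto κ atTop atTop ∧ ∀ᶠ n in atTop, p (κ n) n := by
  classical
  refine ⟨fun n => Nat.findGreatest (fun m => p m n) n, tendsto_atTop.2 fun m => ?_, ?_⟩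
  · filter_upwards [hp m, eventually_ge_atTop m] with n hpn hmn
    exact Nat.le_findGreatest hmn hpn
  · filter_upwards [hp 0] with n hpn
    exact Nat.findGreatest_spec (P := fun m => p m n) n.zero_le hpn

theorem exists_tendsto_atTop_forall_le {E : Type*} [SeminormedAddCommGroup E] {f : ℕ → ℕ → E}
    (hf : ∀ m, Tendsto (f m) atTop (𝓝 0)) :
    ∃ κ : ℕ → ℕ, Tendsto κ atTop atTop ∧ Tendsto (fun n => (κ n : ℝ) / n) atTop (𝓝 0) ∧
      ∀ k : ℕ → ℕ, (∀ᶠ n in atTop, k n ≤ κ n) → Tendsto (fun n => f (k n) n) atTop (𝓝 0) := by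
  have hsmall (m : ℕ) : ∀ᶠ n : ℕ in atTop,
      (m : ℝ) / n ≤ 1 / (m + 1) ∧ ∀ j ≤ m, ‖f j n‖ ≤ 1 / (m + 1) :=
    ((tendsto_const_div_atTop_nhds_zero_nat (m : ℝ)).eventually_le_const (by positivity)).and <|
      (Set.finite_Iic m).eventually_all.2 fun j _ =>
        (hf j).norm.eventually_le_const (by rw [norm_zero]; positivity)
  obtain ⟨κ, hκ, hle⟩ := exists_tendsto_atTop_eventually hsmall
  have hlim : Tendsto (fun n => 1 / ((κ n : ℝ) + 1)) atTop (𝓝 0) :=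
    tendsto_one_div_add_atTop_nhds_zero_nat.comp hκ
  refine ⟨κ, hκ, squeeze_zero' (Eventually.of_forall fun n => by positivity)
    (hle.mono fun n hn => hn.1) hlim, fun k hk => squeeze_zero_norm' ?_ hlim⟩
  filter_upwards [hle, hk] with n hn hkn using hn.2 _ hkn

namespace HasLocallyLinearIncrements

variable {Q : ℝ → ℝ}

theorem tendsto_sub_div_increment (h : HasLocallyLinearIncrements Q) (x : ℝ) :
    Tendsto (fun t => (Q (t + x) - Q t) / increment Q t) atTop (𝓝 x) := by
  simpa only [Function.comp_def, id, add_zero] using (h.tendsto_excess_div_increment x).comp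
    (tendsto_id.prodMk (tendsto_const_nhds (x := (0 : ℝ))))

theorem tendsto_increment_add_div_increment (h : HasLocallyLinearIncrements Q) (x : ℝ) :
    Tendsto (fun t => increment Q (t + x) / increment Q t) atTop (𝓝 1) := by
  have hlim := (h.tendsto_sub_div_increment (x + 1)).sub (h.tendsto_sub_div_increment x)
  rw [add_sub_cancel_left] at hlim
  refine hlim.congr fun t => ?_
  rw [← sub_div, sub_sub_sub_cancel_right, ← add_assoc]
  rfl

theorem tendsto_meanExcess_add_div_increment (h : HasLocallyLinearIncrements Q)
    (hQ : Measurable Q) (x : ℝ) :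
    Tendsto (fun t => meanExcess Q (t + x) / increment Q t) atTop (𝓝 1) := by
  have hshift : Tendsto (fun t => t + x) atTop atTop := tendsto_atTop_add_const_right _ x tendsto_id
  have hlim := ((h.tendsto_meanExcess_div_increment hQ).comp hshift).mul
    (h.tendsto_increment_add_div_increment x)
  rw [one_mul] at hlim
  refine hlim.congr' ?_
  filter_upwards [hshift.eventually h.increment_pos] with t ht
  exact div_mul_div_cancel₀ ht.ne'

end HasLocallyLinearIncrements

section Slow

variable {μ : Measure ℝ}

theorem tendsto_gumbelScale_div (h : HasLocallyLinearIncrements (logQuantile μ)) {c : ℝ}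
    (hc : 0 < c) :
    Tendsto (fun y => gumbelScale μ (y / c) / gumbelScale μ y) atTop (𝓝 1) := by
  refine ((h.tendsto_increment_add_div_increment (-Real.log c)).comp
    Real.tendsto_log_atTop).congr' ?_
  filter_upwards [eventually_gt_atTop 0] with y hy
  rw [Function.comp, ← sub_eq_add_neg, ← Real.log_div hy.ne' hc.ne', increment_logQuantile_log hy,
    increment_logQuantile_log (div_pos hy hc)]

theorem tendsto_omegaCenter_sub_div (h : HasLocallyLinearIncrements (logQuantile μ)) {k : ℕ}
    (hk : 0 < k) :
    Tendsto (fun n : ℕ => (omegaCenter μ n k - tailQuantile μ n) / gumbelScale μ n) atTop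
      (𝓝 (zetaGap k - Real.log k)) := by
  have hlog : Tendsto (fun n : ℕ => Real.log n) atTop atTop :=
    Real.tendsto_log_atTop.comp tendsto_natCast_atTop_atTop
  have hlim := ((h.tendsto_sub_div_increment (-Real.log k)).add
    ((h.tendsto_meanExcess_add_div_increment measurable_logQuantile (-Real.log k)).const_mul
      (zetaGap k))).comp hlog
  rw [mul_one, neg_add_eq_sub] at hlim
  refine hlim.congr' ?_
  filter_upwards [eventually_gt_atTop 0] with n hn
  have hn' : (0 : ℝ) < n := Nat.cast_pos.2 hn
  have hk' : (0 : ℝ) < k := Nat.cast_pos.2 hk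
  rw [Function.comp, ← sub_eq_add_neg, ← Real.log_div hn'.ne' hk'.ne', omegaCenter,
    increment_logQuantile_log hn', logQuantile_log hn', logQuantile_log (div_pos hn' hk')]
  ring

theorem tendsto_zetaGap_succ_sub_log_div_omegaScale :
    Tendsto (fun m : ℕ => (zetaGap (m + 1) - Real.log (m + 1)) / omegaScale (m + 1)) atTop
      (𝓝 0) := by
  simpa only [omegaScale_succ, div_div_eq_mul_div, mul_comm] using
    tendsto_sqrt_mul_zetaGap_succ_sub_log.div_atTop tendsto_zetaGap_succ

theorem exists_tendsto_omegaCenter_sub_div (h : HasLocallyLinearIncrements (logQuantile μ)) :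
    ∃ κ : ℕ → ℕ, Tendsto κ atTop atTop ∧ Tendsto (fun n => (κ n : ℝ) / n) atTop (𝓝 0) ∧
      ∀ k : ℕ → ℕ, Tendsto k atTop atTop → (∀ᶠ n in atTop, k n ≤ κ n) →
        Tendsto (fun n : ℕ => gumbelScale μ (n / k n) / gumbelScale μ n) atTop (𝓝 1) ∧
        Tendsto (fun n => (omegaCenter μ n (k n) - tailQuantile μ n) /
          (gumbelScale μ n * omegaScale (k n))) atTop (𝓝 0) := by
  have hfixed (m : ℕ) : Tendsto (fun n : ℕ =>
      (gumbelScale μ (n / (m + 1 : ℕ)) / gumbelScale μ n - 1,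
        (omegaCenter μ n (m + 1) - tailQuantile μ n) / gumbelScale μ n / omegaScale (m + 1) -
          (zetaGap (m + 1) - Real.log (m + 1)) / omegaScale (m + 1))) atTop (𝓝 (0 : ℝ × ℝ)) := by
    have hratio := ((tendsto_gumbelScale_div h (Nat.cast_pos.2 m.succ_pos)).comp
      tendsto_natCast_atTop_atTop).sub_const 1
    have hcenter := ((tendsto_omegaCenter_sub_div h m.succ_pos).div_const
      (omegaScale (m + 1))).sub_const ((zetaGap (m + 1) - Real.log (m + 1)) / omegaScale (m + 1))
    rw [Nat.succ_eq_add_one, Nat.cast_add_one, sub_self] at hcenter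
    rw [sub_self] at hratio
    exact hratio.prodMk_nhds hcenter
  obtain ⟨κ, hκ, hκn, hlim⟩ := exists_tendsto_atTop_forall_le hfixed
  refine ⟨κ, hκ, hκn, fun k hk hkκ => ?_⟩
  have hpair := hlim (fun n => k n - 1) (hkκ.mono fun n hn => (Nat.sub_le _ _).trans hn)
  have hm : Tendsto (fun n => k n - 1) atTop atTop := (tendsto_sub_atTop_nat 1).comp hk
  have hbias := tendsto_zetaGap_succ_sub_log_div_omegaScale.comp hm
  have hratio := hpair.fst_nhds.add_const 1
  have hcenter := hpair.snd_nhds.add hbias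
  simp only [Function.comp_def, sub_add_cancel, Prod.fst_zero, Prod.snd_zero, zero_add,
    div_div] at hratio hcenter
  constructor
  · refine hratio.congr' ?_
    filter_upwards [hk.eventually_gt_atTop 0] with n hn
    rw [Nat.sub_add_cancel hn]
  · refine hcenter.congr' ?_
    filter_upwards [hk.eventually_gt_atTop 0] with n hn
    rw [Nat.sub_add_cancel hn]

theorem tendstoInDistribution_omegaSample_sub_tailQuantile {Ω : Type*} [MeasurableSpace Ω]
    {P : Measure Ω} [IsProbabilityMeasure P] {Y : ℕ → Ω → ℝ} [IsProbabilityMeasure μ]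
    (h : HasLocallyLinearIncrements (logQuantile μ)) (hlaw : ∀ i, HasLaw (Y i) μ P)
    (hindep : iIndepFun Y P) {k : ℕ → ℕ} (hk : Tendsto k atTop atTop)
    (hkn : Tendsto (fun n => (k n : ℝ) / n) atTop (𝓝 0))
    (hratio : Tendsto (fun n : ℕ => gumbelScale μ (n / k n) / gumbelScale μ n) atTop (𝓝 1))
    (hcenter : Tendsto (fun n => (omegaCenter μ n (k n) - tailQuantile μ n) /
      (gumbelScale μ n * omegaScale (k n))) atTop (𝓝 0)) :
    TendstoInDistribution (fun n ω => (omegaSample Y n (k n) ω - tailQuantile μ n) /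
      (gumbelScale μ n * omegaScale (k n))) atTop id (fun _ => P) (gaussianReal 0 1) := by
  have haffine := tendstoInDistribution_affine
    (tendstoInDistribution_omegaSample h hlaw hindep hk hkn) hratio hcenter
  refine tendstoInDistribution_of_eventually_map_eq haffine (fun n =>
    ((aemeasurable_omegaSample (fun i => (hlaw i).aemeasurable) n (k n)).sub_const _).div_const _)
    ?_
  filter_upwards [hratio.eventually_ne one_ne_zero] with n hne
  have hscale : gumbelScale μ (n / k n) ≠ 0 := (div_ne_zero_iff.1 hne).1
  congr 1
  funext ω
  rw [div_mul_div_comm, mul_left_comm (gumbelScale μ n), mul_div_mul_left _ _ hscale, ← add_div,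
    sub_add_sub_cancel]

end Slow

section Slope

variable {Q b : ℝ → ℝ}

/- On a window of length `2 * M` the slopes `b` agree up to a factor `C`, so all chords in it have
slopes agreeing up to `C ^ 3`. -/
theorem eventually_chord_le_mul_slope {C : ℝ} (hC : 0 < C) {T : ℝ}
    (hanti : AntitoneOn b (Set.Ici T))
    (hlong : ∀ M > 0, ∀ᶠ t in atTop, b t ≤ C * b (t + M))
    (hlower : ∀ᶠ t in atTop, ∀ s, t ≤ s → (s - t) * b s ≤ C * (Q s - Q t))
    (hupper : ∀ᶠ t in atTop, ∀ s, t ≤ s → Q s - Q t ≤ C * ((s - t) * b t))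
    {M : ℝ} (hM : 0 < M) :
    ∀ᶠ t in atTop, ∀ x ≤ M, ∀ y, -M ≤ y → y ≤ x →
      Q (t + x) - Q (t + y) ≤ C * ((x - y) * b (t - M)) ∧
      (x - y) * b (t - M) ≤ C ^ 2 * (Q (t + x) - Q (t + y)) := by
  obtain ⟨T', hT'⟩ := eventually_atTop.1 ((hlower.and hupper).and (eventually_ge_atTop T))
  have hshift : Tendsto (fun t => t - M) atTop atTop := tendsto_atTop_add_const_right _ _ tendsto_id
  filter_upwards [hshift.eventually (hlong (2 * M) (by linarith)), hshift.eventually_ge_atTop T']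
    with t hwindow ht x hx y hy hyx
  have hfactor : b (t - M) ≤ C * b (t + M) := by
    convert hwindow using 3; ring
  obtain ⟨⟨hlow, hupp⟩, hTy⟩ := hT' (t + y) (by linarith)
  have : 0 ≤ x - y := sub_nonneg.2 hyx
  have hleft : b (t + y) ≤ b (t - M) :=
    hanti (hT' _ ht).2 hTy (by linarith)
  have hright : b (t + M) ≤ b (t + x) :=
    hanti (hTy.trans (by linarith : t + y ≤ t + x)) (hTy.trans (by linarith : t + y ≤ t + M))
      (by linarith)
  have hlow := hlow (t + x) (by linarith)
  have hupp := hupp (t + x) (by linarith)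
  rw [add_sub_add_left_eq_sub] at hlow hupp
  refine ⟨hupp.trans (by gcongr), ?_⟩
  calc (x - y) * b (t - M) ≤ (x - y) * (C * b (t + x)) := by
        gcongr; exact hfactor.trans (by gcongr)
    _ = C * ((x - y) * b (t + x)) := by ring
    _ ≤ C * (C * (Q (t + x) - Q (t + y))) := by gcongr
    _ = C ^ 2 * (Q (t + x) - Q (t + y)) := by ring

theorem eventually_chord_le_mul_increment {C : ℝ} (hC : 0 < C) {T : ℝ}
    (hanti : AntitoneOn b (Set.Ici T))
    (hlong : ∀ M > 0, ∀ᶠ t in atTop, b t ≤ C * b (t + M))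
    (hlower : ∀ᶠ t in atTop, ∀ s, t ≤ s → (s - t) * b s ≤ C * (Q s - Q t))
    (hupper : ∀ᶠ t in atTop, ∀ s, t ≤ s → Q s - Q t ≤ C * ((s - t) * b t))
    {M : ℝ} (hM : 1 ≤ M) :
    ∀ᶠ t in atTop, ∀ x ≤ M, ∀ y, -M ≤ y → y ≤ x →
      Q (t + x) - Q (t + y) ≤ C ^ 3 * ((x - y) * increment Q t) ∧
      (x - y) * increment Q t ≤ C ^ 3 * (Q (t + x) - Q (t + y)) := by
  have hM0 : 0 < M := zero_lt_one.trans_le hM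
  filter_upwards [eventually_chord_le_mul_slope hC hanti hlong hlower hupper hM0]
    with t hchord x hx y hy hyx
  obtain ⟨hupp, hlow⟩ := hchord x hx y hy hyx
  obtain ⟨hupp₁, hlow₁⟩ := hchord 1 hM 0 (neg_nonpos.2 hM0.le) zero_le_one
  rw [add_zero, sub_zero, one_mul] at hupp₁ hlow₁
  have : 0 ≤ x - y := sub_nonneg.2 hyx
  constructor
  · calc Q (t + x) - Q (t + y) ≤ C * ((x - y) * b (t - M)) := hupp
      _ ≤ C * ((x - y) * (C ^ 2 * increment Q t)) := by gcongr; exact hlow₁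
      _ = C ^ 3 * ((x - y) * increment Q t) := by ring
  · calc (x - y) * increment Q t ≤ (x - y) * (C * b (t - M)) := by gcongr; exact hupp₁
      _ = C * ((x - y) * b (t - M)) := by ring
      _ ≤ C * (C ^ 2 * (Q (t + x) - Q (t + y))) := by gcongr
      _ = C ^ 3 * (Q (t + x) - Q (t + y)) := by ring

theorem eventually_slope_le_mul_increment (hpos : ∀ᶠ t in atTop, 0 < b t)
    (hlong : ∀ M > 0, ∀ᶠ t in atTop, b t ≤ 2 * b (t + M))
    (hlower : ∀ᶠ t in atTop, ∀ s, t ≤ s → (s - t) * b s ≤ 2 * (Q s - Q t)) :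
    ∀ᶠ t in atTop, 0 < increment Q t ∧ b (t - 1) ≤ 4 * increment Q t := by
  have hshift (x : ℝ) : Tendsto (fun t => t + x) atTop atTop :=
    tendsto_atTop_add_const_right _ _ tendsto_id
  filter_upwards [(hshift 1).eventually hpos, hlower,
    (hshift (-1)).eventually (hlong 2 two_pos)] with t hb hlow hfactor
  have hlow := hlow (t + 1) (by linarith)
  rw [add_sub_cancel_left, one_mul, ← increment] at hlow
  rw [← sub_eq_add_neg, show t - 1 + 2 = t + 1 by ring] at hfactor
  constructor <;> linarith

theorem eventually_abs_chord_sub_le {C ε : ℝ} (hC : 1 < C) (hCε : C ^ 3 ≤ 1 + ε) {T : ℝ}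
    (hanti : AntitoneOn b (Set.Ici T))
    (hlong : ∀ M > 0, ∀ᶠ t in atTop, b t ≤ C * b (t + M))
    (hlower : ∀ᶠ t in atTop, ∀ s, t ≤ s → (s - t) * b s ≤ C * (Q s - Q t))
    (hupper : ∀ᶠ t in atTop, ∀ s, t ≤ s → Q s - Q t ≤ C * ((s - t) * b t))
    (hinc : ∀ᶠ t in atTop, 0 < increment Q t) (M : ℝ) :
    ∀ᶠ t in atTop, ∀ x ∈ Set.Icc (-M) M, ∀ y ∈ Set.Icc (-M) M,
      |Q (t + x) - Q (t + y) - (x - y) * increment Q t| ≤ ε * |x - y| * increment Q t := by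
  filter_upwards [hinc, eventually_chord_le_mul_increment (zero_lt_one.trans hC) hanti hlong
    hlower hupper (le_max_right M 1)] with t ha hchord x hx y hy
  wlog hyx : y ≤ x generalizing x y
  · have hswap := this y hy x hx (le_of_not_ge hyx)
    rw [abs_sub_comm y x, ← abs_neg] at hswap
    convert hswap using 2
    ring
  obtain ⟨hle, hge⟩ := hchord x (hx.2.trans (le_max_left _ _)) y
    ((neg_le_neg (le_max_left _ _)).trans hy.1) hyx
  have ha' : 0 ≤ (x - y) * increment Q t := mul_nonneg (sub_nonneg.2 hyx) ha.le
  have hQ : 0 ≤ Q (t + x) - Q (t + y) :=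
    nonneg_of_mul_nonneg_right (ha'.trans hge) (pow_pos (zero_lt_one.trans hC) 3)
  have hε : 0 ≤ ε := by linarith [one_le_pow₀ hC.le (n := 3)]
  have hle := hle.trans (mul_le_mul_of_nonneg_right hCε ha')
  have hge := hge.trans (mul_le_mul_of_nonneg_right hCε hQ)
  rw [abs_of_nonneg (sub_nonneg.2 hyx), mul_assoc, abs_le]
  rcases le_total (Q (t + x) - Q (t + y)) ((x - y) * increment Q t) with hDA | hDA
  · constructor <;> linarith [mul_le_mul_of_nonneg_left hDA hε]
  · constructor <;> linarith [mul_nonneg hε ha']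

theorem eventually_abs_chord_le {T : ℝ} (hanti : AntitoneOn b (Set.Ici T))
    (hlower : ∀ᶠ t in atTop, ∀ s, t ≤ s → (s - t) * b s ≤ 2 * (Q s - Q t))
    (hupper : ∀ᶠ t in atTop, ∀ s, t ≤ s → Q s - Q t ≤ 2 * ((s - t) * b t))
    (hpos : ∀ᶠ t in atTop, 0 < b t)
    (hinc : ∀ᶠ t in atTop, b (t - 1) ≤ 4 * increment Q t) :
    ∀ᶠ t in atTop, ∀ x, -1 ≤ x → ∀ y, -1 ≤ y →
      |Q (t + x) - Q (t + y)| ≤ 8 * |x - y| * increment Q t := by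
  obtain ⟨T', hT'⟩ := eventually_atTop.1
    ((hlower.and hupper).and (hpos.and (eventually_ge_atTop T)))
  filter_upwards [hinc, eventually_ge_atTop (T' + 1)] with t hb ht x hx y hy
  wlog hyx : y ≤ x generalizing x y
  · rw [abs_sub_comm, abs_sub_comm x]
    exact this y hy x hx (le_of_not_ge hyx)
  obtain ⟨⟨hlow, hupp⟩, -, hTy⟩ := hT' (t + y) (by linarith)
  have hlow := hlow (t + x) (by linarith)
  have hupp := hupp (t + x) (by linarith)
  rw [add_sub_add_left_eq_sub] at hlow hupp
  have hxy : 0 ≤ x - y := sub_nonneg.2 hyx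
  have hleft : b (t + y) ≤ 4 * increment Q t :=
    (hanti (hT' _ (by linarith)).2.2 hTy (by linarith)).trans hb
  have hbx : 0 ≤ (x - y) * b (t + x) := mul_nonneg hxy (hT' _ (by linarith)).2.1.le
  rw [abs_of_nonneg hxy, abs_of_nonneg (by linarith)]
  calc Q (t + x) - Q (t + y) ≤ 2 * ((x - y) * (4 * increment Q t)) := hupp.trans (by gcongr)
    _ = 8 * (x - y) * increment Q t := by ring

theorem hasLocallyLinearIncrements_of_slope (hpos : ∀ᶠ t in atTop, 0 < b t) {T : ℝ}
    (hanti : AntitoneOn b (Set.Ici T))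
    (hlong : ∀ C > 1, ∀ M > 0, ∀ᶠ t in atTop, b t ≤ C * b (t + M))
    (hlower : ∀ C > 1, ∀ᶠ t in atTop, ∀ s, t ≤ s → (s - t) * b s ≤ C * (Q s - Q t))
    (hupper : ∀ C > 1, ∀ᶠ t in atTop, ∀ s, t ≤ s → Q s - Q t ≤ C * ((s - t) * b t)) :
    HasLocallyLinearIncrements Q := by
  have hinc := eventually_slope_le_mul_increment hpos (hlong 2 one_lt_two) (hlower 2 one_lt_two)
  refine ⟨hinc.mono fun t ht => ht.1, fun M ε hε => ?_, 8,
    eventually_abs_chord_le hanti (hlower 2 one_lt_two) (hupper 2 one_lt_two) hpos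
      (hinc.mono fun t ht => ht.2)⟩
  have hcube : ∀ᶠ C : ℝ in 𝓝[>] 1, C ^ 3 < 1 + ε :=
    (((continuous_pow 3).tendsto' (1 : ℝ) 1 (one_pow 3)).mono_left
      nhdsWithin_le_nhds).eventually_lt_const (lt_add_of_pos_right 1 hε)
  obtain ⟨C, hCε, hC⟩ := (hcube.and self_mem_nhdsWithin).exists
  exact eventually_abs_chord_sub_le hC hCε.le hanti (hlong C hC) (hlower C hC) (hupper C hC)
    (hinc.mono fun t ht => ht.1) M

end Slope

section Elasticity

variable {h Q : ℝ → ℝ} {ρ : ℝ}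

theorem eventually_differentiableAt_of_tendsto_elasticity
    (hel : Tendsto (fun y => y * deriv h y / h y) atTop (𝓝 ρ)) (hρ : ρ ≠ 0) :
    ∀ᶠ y in atTop, DifferentiableAt ℝ h y := by
  filter_upwards [hel.eventually_ne hρ] with y hy
  exact differentiableAt_of_deriv_ne_zero (right_ne_zero_of_mul (left_ne_zero_of_mul hy))

theorem exists_monotoneOn_div_self (hpos : ∀ᶠ y in atTop, 0 < h y)
    (hel : Tendsto (fun y => y * deriv h y / h y) atTop (𝓝 ρ)) (hρ : 1 < ρ) :
    ∃ y₀, MonotoneOn (fun y => h y / y) (Set.Ici y₀) := by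
  obtain ⟨y₀, hy₀⟩ := eventually_atTop.1 ((hpos.and (eventually_gt_atTop 0)).and
    ((hel.eventually_const_lt hρ).and (eventually_differentiableAt_of_tendsto_elasticity hel
      (zero_lt_one.trans hρ).ne')))
  have hderiv (y : ℝ) (hy : y₀ ≤ y) :
      HasDerivAt (fun y => h y / y) ((deriv h y * y - h y * 1) / y ^ 2) y :=
    (hy₀ y hy).2.2.hasDerivAt.div (hasDerivAt_id y) (hy₀ y hy).1.2.ne'
  refine ⟨y₀, monotoneOn_of_deriv_nonneg (convex_Ici y₀)
    (fun y hy => (hderiv y hy).continuousAt.continuousWithinAt)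
    (fun y hy => (hderiv y (interior_subset hy)).differentiableAt.differentiableWithinAt)
    fun y hy => ?_⟩
  obtain ⟨⟨hh, -⟩, hone, -⟩ := hy₀ y (interior_subset hy)
  rw [lt_div_iff₀ hh] at hone
  rw [(hderiv y (interior_subset hy)).deriv]
  exact div_nonneg (by linarith) (sq_nonneg y)

theorem eventually_mul_sub_le_sub (hpos : ∀ᶠ y in atTop, 0 < h y)
    (hel : Tendsto (fun y => y * deriv h y / h y) atTop (𝓝 ρ)) (hρ : 1 < ρ) {c : ℝ}
    (hc : 0 ≤ c) (hcρ : c < ρ) :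
    ∀ᶠ y in atTop, ∀ z, y ≤ z → c * (h y / y) * (z - y) ≤ h z - h y := by
  obtain ⟨y₀, hmono⟩ := exists_monotoneOn_div_self hpos hel hρ
  obtain ⟨y₁, hy₁⟩ := eventually_atTop.1 ((hpos.and (eventually_gt_atTop 0)).and
    ((hel.eventually_const_lt hcρ).and (eventually_differentiableAt_of_tendsto_elasticity hel
      (zero_lt_one.trans hρ).ne')))
  filter_upwards [eventually_ge_atTop (max y₀ y₁)] with y hy z hyz
  have hy0 := (le_max_left _ _).trans hy
  have hy1 := (le_max_right _ _).trans hy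
  refine (convex_Icc y z).mul_sub_le_image_sub_of_le_deriv
    (fun x hx => (hy₁ x (hy1.trans hx.1)).2.2.continuousAt.continuousWithinAt)
    (fun x hx => (hy₁ x (hy1.trans (interior_subset hx).1)).2.2.differentiableWithinAt)
    (fun x hx => ?_) y (Set.left_mem_Icc.2 hyz) z (Set.right_mem_Icc.2 hyz) hyz
  obtain ⟨hyx, -⟩ := interior_subset hx
  obtain ⟨⟨hh, hx0⟩, hder, -⟩ := hy₁ x (hy1.trans hyx)
  rw [lt_div_iff₀ hh, ← div_lt_iff₀' hx0] at hder
  calc c * (h y / y) ≤ c * (h x / x) :=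
        mul_le_mul_of_nonneg_left (hmono hy0 (hy0.trans hyx) hyx) hc
    _ ≤ deriv h x := by rw [← mul_div_assoc]; exact hder.le

theorem eventually_sub_le_mul_sub (hpos : ∀ᶠ y in atTop, 0 < h y)
    (hel : Tendsto (fun y => y * deriv h y / h y) atTop (𝓝 ρ)) (hρ : 1 < ρ) {C : ℝ}
    (hCρ : ρ < C) :
    ∀ᶠ y in atTop, ∀ z, y ≤ z → h z - h y ≤ C * (h z / z) * (z - y) := by
  obtain ⟨y₀, hmono⟩ := exists_monotoneOn_div_self hpos hel hρ
  obtain ⟨y₁, hy₁⟩ := eventually_atTop.1 ((hpos.and (eventually_gt_atTop 0)).and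
    ((hel.eventually_lt_const hCρ).and (eventually_differentiableAt_of_tendsto_elasticity hel
      (zero_lt_one.trans hρ).ne')))
  filter_upwards [eventually_ge_atTop (max y₀ y₁)] with y hy z hyz
  have hy0 := (le_max_left _ _).trans hy
  have hy1 := (le_max_right _ _).trans hy
  refine (convex_Icc y z).image_sub_le_mul_sub_of_deriv_le
    (fun x hx => (hy₁ x (hy1.trans hx.1)).2.2.continuousAt.continuousWithinAt)
    (fun x hx => (hy₁ x (hy1.trans (interior_subset hx).1)).2.2.differentiableWithinAt)
    (fun x hx => ?_) y (Set.left_mem_Icc.2 hyz) z (Set.right_mem_Icc.2 hyz) hyz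
  obtain ⟨hyx, hxz⟩ := interior_subset hx
  obtain ⟨⟨hh, hx0⟩, hder, -⟩ := hy₁ x (hy1.trans hyx)
  rw [div_lt_iff₀ hh, ← lt_div_iff₀' hx0] at hder
  calc deriv h x ≤ C * (h x / x) := by rw [← mul_div_assoc]; exact hder.le
    _ ≤ C * (h z / z) := mul_le_mul_of_nonneg_left (hmono (hy0.trans hyx) (hy0.trans hyz) hxz)
        (zero_lt_one.trans (hρ.trans hCρ)).le

theorem eventually_rightInverse_sub_le (hpos : ∀ᶠ y in atTop, 0 < h y)
    (hel : Tendsto (fun y => y * deriv h y / h y) atTop (𝓝 ρ)) (hρ : 1 < ρ)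
    (hQ : Tendsto Q atTop atTop) (hmono : MonotoneOn Q (Set.Ioi 0))
    (hinv : Set.RightInvOn Q h (Set.Ioi 0)) {C : ℝ} (hC : 1 < C) :
    ∀ᶠ t in atTop, ∀ s, t ≤ s → Q s - Q t ≤ C * ((s - t) * (Q t / (ρ * t))) := by
  have hρ0 : 0 < ρ := zero_lt_one.trans hρ
  have hC0 : 0 < C := zero_lt_one.trans hC
  filter_upwards [eventually_gt_atTop 0, hQ.eventually (eventually_gt_atTop 0), hQ.eventually
    (eventually_mul_sub_le_sub hpos hel hρ (div_pos hρ0 hC0).le (div_lt_self hρ0 hC))]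
    with t ht hQt hle s hs
  have hs0 : 0 < s := ht.trans_le hs
  have hle := hle (Q s) (hmono ht hs0 hs)
  rw [hinv ht, hinv hs0, ← le_div_iff₀' (by positivity)] at hle
  refine hle.trans_eq ?_
  field_simp

theorem eventually_le_rightInverse_sub (hpos : ∀ᶠ y in atTop, 0 < h y)
    (hel : Tendsto (fun y => y * deriv h y / h y) atTop (𝓝 ρ)) (hρ : 1 < ρ)
    (hQ : Tendsto Q atTop atTop) (hmono : MonotoneOn Q (Set.Ioi 0))
    (hinv : Set.RightInvOn Q h (Set.Ioi 0)) {C : ℝ} (hC : 1 < C) :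
    ∀ᶠ t in atTop, ∀ s, t ≤ s → (s - t) * (Q s / (ρ * s)) ≤ C * (Q s - Q t) := by
  have hρ0 : 0 < ρ := zero_lt_one.trans hρ
  filter_upwards [eventually_gt_atTop 0, hQ.eventually (eventually_gt_atTop 0), hQ.eventually
    (eventually_sub_le_mul_sub hpos hel hρ (lt_mul_of_one_lt_left hρ0 hC))] with t ht hQt hle s hs
  have hs0 : 0 < s := ht.trans_le hs
  have hQs : 0 < Q s := hQt.trans_le (hmono ht hs0 hs)
  have hle := hle (Q s) (hmono ht hs0 hs)
  rw [hinv ht, hinv hs0] at hle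
  calc (s - t) * (Q s / (ρ * s)) ≤ C * ρ * (s / Q s) * (Q s - Q t) * (Q s / (ρ * s)) := by gcongr
    _ = C * (Q s - Q t) := by field_simp

theorem exists_antitoneOn_rightInverse_div (hpos : ∀ᶠ y in atTop, 0 < h y)
    (hel : Tendsto (fun y => y * deriv h y / h y) atTop (𝓝 ρ)) (hρ : 1 < ρ)
    (hQ : Tendsto Q atTop atTop) (hmono : MonotoneOn Q (Set.Ioi 0))
    (hinv : Set.RightInvOn Q h (Set.Ioi 0)) :
    ∃ T, AntitoneOn (fun t => Q t / (ρ * t)) (Set.Ici T) := by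
  have : 0 < ρ := zero_lt_one.trans hρ
  obtain ⟨T, hT⟩ := eventually_atTop.1 ((eventually_gt_atTop 0).and
    (eventually_rightInverse_sub_le hpos hel hρ hQ hmono hinv hρ))
  refine ⟨T, fun t ht s hs hts => ?_⟩
  have ht0 : 0 < t := (hT t ht).1
  have hs0 : 0 < s := (hT s hs).1
  have hle := (hT t ht).2 s hts
  rw [sub_le_iff_le_add] at hle
  calc Q s / (ρ * s) ≤ (ρ * ((s - t) * (Q t / (ρ * t))) + Q t) / (ρ * s) := by gcongr
    _ = Q t / (ρ * t) := by field_simp; ring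

/- The slope of `Q` at `t` is about `Q t / (ρ * t)`, because `1 / deriv h y` is about
`y / (ρ * h y)`. -/
theorem hasLocallyLinearIncrements_of_rightInvOn (hpos : ∀ᶠ y in atTop, 0 < h y)
    (hel : Tendsto (fun y => y * deriv h y / h y) atTop (𝓝 ρ)) (hρ : 1 < ρ)
    (hQ : Tendsto Q atTop atTop) (hmono : MonotoneOn Q (Set.Ioi 0))
    (hinv : Set.RightInvOn Q h (Set.Ioi 0)) : HasLocallyLinearIncrements Q := by
  have : 0 < ρ := zero_lt_one.trans hρ
  obtain ⟨T, hanti⟩ := exists_antitoneOn_rightInverse_div hpos hel hρ hQ hmono hinv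
  have hslope : ∀ᶠ t in atTop, 0 < Q t / (ρ * t) := by
    filter_upwards [hQ.eventually_gt_atTop 0, eventually_gt_atTop 0] with t hQt ht
    positivity
  refine hasLocallyLinearIncrements_of_slope hslope hanti (fun C hC M hM => ?_)
    (fun C hC => eventually_le_rightInverse_sub hpos hel hρ hQ hmono hinv hC)
    (fun C hC => eventually_rightInverse_sub_le hpos hel hρ hQ hmono hinv hC)
  filter_upwards [eventually_gt_atTop 0, hQ.eventually_gt_atTop 0,
    eventually_ge_atTop (M / (C - 1))] with t ht hQt htM
  have htM : t + M ≤ C * t := by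
    rw [div_le_iff₀ (sub_pos.2 hC)] at htM
    linarith
  have hQM : Q t ≤ Q (t + M) := hmono ht (add_pos ht hM) (by linarith)
  have : 0 < Q (t + M) := hQt.trans_le hQM
  calc Q t / (ρ * t) ≤ Q (t + M) / (ρ * t) := by gcongr
    _ = C * (Q (t + M) / (ρ * (C * t))) := by field_simp
    _ ≤ C * (Q (t + M) / (ρ * (t + M))) := by gcongr

end Elasticity

section Hazard

variable {μ : Measure ℝ}

theorem cdf_quantile (hF : Continuous (cdf μ)) {p : ℝ} (hp0 : 0 < p) (hp1 : p < 1) :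
    cdf μ (quantile μ p) = p := by
  refine le_antisymm ?_ ((quantile_le_iff hp0 hp1 _).1 le_rfl)
  refine le_of_tendsto (hF.continuousWithinAt (s := Set.Iio (quantile μ p))).tendsto ?_
  filter_upwards [self_mem_nhdsWithin] with x hx
  exact (not_le.1 (mt (quantile_le_iff hp0 hp1 x).2 (not_le.2 hx))).le

/-- The cumulative hazard function `-log (1 - F)` of a law on the line; under continuity of `F` it
is a left inverse of the logarithmic quantile function. -/
noncomputable def hazard (μ : Measure ℝ) (y : ℝ) : ℝ :=
  -Real.log (1 - cdf μ y)

theorem rightInvOn_logQuantile_hazard (hF : Continuous (cdf μ)) :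
    Set.RightInvOn (logQuantile μ) (hazard μ) (Set.Ioi 0) := by
  intro s hs
  rw [hazard, logQuantile_eq_quantile,
    cdf_quantile hF (sub_pos.2 (Real.exp_lt_one_iff.2 (neg_neg_iff_pos.2 hs)))
      (sub_lt_self 1 (Real.exp_pos _)), sub_sub_cancel, Real.log_exp, neg_neg]

theorem tendsto_logQuantile_atTop (hlt : ∀ y, cdf μ y < 1) :
    Tendsto (logQuantile μ) atTop atTop := by
  refine tendsto_atTop.2 fun y => ?_
  have hexp : Tendsto (fun s : ℝ => 1 - Real.exp (-s)) atTop (𝓝 1) := by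
    simpa only [sub_zero] using Real.tendsto_exp_neg_atTop_nhds_zero.const_sub 1
  filter_upwards [hexp.eventually_const_lt (hlt y), eventually_gt_atTop 0] with s hs hs0
  exact (not_le.1 (mt (logQuantile_le_iff hs0 y).1 (not_le.2 hs))).le

theorem eventually_hazard_pos (hlt : ∀ y, cdf μ y < 1) : ∀ᶠ y in atTop, 0 < hazard μ y := by
  filter_upwards [(tendsto_cdf_atTop μ).eventually_const_lt zero_lt_one] with y hy
  exact neg_pos.2 (Real.log_neg (sub_pos.2 (hlt y)) (sub_lt_self 1 hy))

namespace IsLogExpPowerLaw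

variable {ρ : ℝ}

theorem cdf_lt_one (hμ : IsLogExpPowerLaw μ ρ) (y : ℝ) : cdf μ y < 1 := by
  obtain ⟨L, hL, -⟩ := hμ.exists_slowlyVarying
  obtain ⟨z, hz, hyz⟩ := (hL.and (eventually_ge_atTop y)).exists
  exact (monotone_cdf μ hyz).trans_lt (sub_pos.1 (hz ▸ Real.exp_pos _))

theorem tendsto_elasticity_hazard (hμ : IsLogExpPowerLaw μ ρ) :
    Tendsto (fun y => y * deriv (hazard μ) y / hazard μ y) atTop (𝓝 ρ) := by
  obtain ⟨L, hL, -, hdiff, hel, -⟩ := hμ.exists_slowlyVarying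
  have hhazard : ∀ᶠ y in atTop, hazard μ y = L y * y ^ ρ := by
    filter_upwards [hL] with y hy
    rw [hazard, hy, Real.log_exp, neg_neg]
  obtain ⟨y₀, hy₀⟩ := eventually_atTop.1 hhazard
  have hlim := hel.add_const ρ
  rw [zero_add] at hlim
  refine hlim.congr' ?_
  filter_upwards [hdiff, eventually_hazard_pos hμ.cdf_lt_one, eventually_gt_atTop 0,
    eventually_gt_atTop y₀] with y hdiff hpos hy hyy₀
  have hderiv : HasDerivAt (hazard μ) (deriv L y * y ^ ρ + L y * (ρ * y ^ (ρ - 1))) y :=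
    (hdiff.1.hasDerivAt.mul (Real.hasDerivAt_rpow_const (Or.inl hy.ne'))).congr_of_eventuallyEq
      ((lt_mem_nhds hyy₀).mono fun z hz => hy₀ z hz.le)
  rw [hy₀ y hyy₀.le] at hpos ⊢
  have hL0 : L y ≠ 0 := left_ne_zero_of_mul hpos.ne'
  rw [hderiv.deriv, Real.rpow_sub_one hy.ne']
  field_simp

theorem hasLocallyLinearIncrements_logQuantile (hμ : IsLogExpPowerLaw μ ρ) :
    HasLocallyLinearIncrements (logQuantile μ) :=
  hasLocallyLinearIncrements_of_rightInvOn (eventually_hazard_pos hμ.cdf_lt_one)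
    hμ.tendsto_elasticity_hazard hμ.one_lt (tendsto_logQuantile_atTop hμ.cdf_lt_one)
    monotoneOn_logQuantile (rightInvOn_logQuantile_hazard hμ.continuous_cdf)

end IsLogExpPowerLaw

end Hazard

theorem proposition3_general
    {Ω : Type*} [MeasurableSpace Ω] {P : Measure Ω} [IsProbabilityMeasure P]
    {Y : ℕ → Ω → ℝ} {μ : Measure ℝ} [IsProbabilityMeasure μ]
    (h : HasLocallyLinearIncrements (logQuantile μ))
    (hlaw : ∀ i, HasLaw (Y i) μ P) (hindep : iIndepFun Y P)
    {Ω' : ℕ → Type*} [∀ k, MeasurableSpace (Ω' k)] {P' : (k : ℕ) → Measure (Ω' k)}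
    [∀ k, IsProbabilityMeasure (P' k)] {G : (k : ℕ) → Ω' k → Fin k → ℝ}
    (hG : ∀ k, HasLaw (G k) (gumbelTopLaw k) (P' k)) :
    TendstoInDistribution (fun k ω => omegaStat k (G k ω) / omegaScale k) atTop
      id P' (gaussianReal 0 1) ∧
    (∀ k : ℕ → ℕ, Tendsto k atTop atTop → Tendsto (fun n => (k n : ℝ) / n) atTop (𝓝 0) →
      ∃ c : ℕ → ℝ, TendstoInDistribution
        (fun n ω => (omegaSample Y n (k n) ω - c n) /
          (gumbelScale μ (n / k n) * omegaScale (k n))) atTop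
        id (fun _ => P) (gaussianReal 0 1)) ∧
    (∃ κ : ℕ → ℕ, Tendsto κ atTop atTop ∧ Tendsto (fun n => (κ n : ℝ) / n) atTop (𝓝 0) ∧
      ∀ k : ℕ → ℕ, Tendsto k atTop atTop → (∀ᶠ n in atTop, k n ≤ κ n) →
        TendstoInDistribution
          (fun n ω => (omegaSample Y n (k n) ω - tailQuantile μ n) /
            (gumbelScale μ n * omegaScale (k n))) atTop
          id (fun _ => P) (gaussianReal 0 1)) := by
  obtain ⟨κ, hκ, hκn, hcenter⟩ := exists_tendsto_omegaCenter_sub_div h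
  refine ⟨tendstoInDistribution_omegaStat_gumbelTopLaw P' G hG,
    fun k hk hkn => ⟨_, tendstoInDistribution_omegaSample h hlaw hindep hk hkn⟩,
    κ, hκ, hκn, fun k hk hkκ => ?_⟩
  have hkn : Tendsto (fun n => (k n : ℝ) / n) atTop (𝓝 0) := by
    refine squeeze_zero' (Eventually.of_forall fun n => by positivity) ?_ hκn
    filter_upwards [hkκ] with n hn
    gcongr
  obtain ⟨hratio, hbias⟩ := hcenter k hk hkκ
  exact tendstoInDistribution_omegaSample_sub_tailQuantile h hlaw hindep hk hkn hratio hbias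

theorem proposition3
    {Ω : Type*} [MeasurableSpace Ω] (P : Measure Ω) [IsProbabilityMeasure P]
    (Y : ℕ → Ω → ℝ) (μ : Measure ℝ) [IsProbabilityMeasure μ] (ρ : ℝ)
    (hμ : IsLogExpPowerLaw μ ρ)
    (hlaw : ∀ i, HasLaw (Y i) μ P) (hindep : iIndepFun Y P)
    {Ω' : ℕ → Type*} [∀ k, MeasurableSpace (Ω' k)] (P' : (k : ℕ) → Measure (Ω' k))
    [∀ k, IsProbabilityMeasure (P' k)] (G : (k : ℕ) → Ω' k → Fin k → ℝ)
    (hG : ∀ k, HasLaw (G k) (gumbelTopLaw k) (P' k)) :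
    -- `Ω_k` applied to a vector with law exactly `Λ^(k)`, as `k → ∞`
    TendstoInDistribution (fun k ω => omegaStat k (G k ω) / omegaScale k) atTop
      id P' (gaussianReal 0 1) ∧
    -- `Ω_k` applied to the sample, along every intermediate sequence
    (∀ k : ℕ → ℕ, Tendsto k atTop atTop →
      Tendsto (fun n => (k n : ℝ) / (n : ℝ)) atTop (𝓝 0) →
      ∃ c : ℕ → ℝ, TendstoInDistribution
        (fun n ω => (omegaSample Y n (k n) ω - c n) /
          (gumbelScale μ ((n : ℝ) / (k n : ℝ)) * omegaScale (k n))) atTop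
        id (fun _ => P) (gaussianReal 0 1)) ∧
    -- `Ω_k` centred at the quantile it estimates, along every slow enough sequence
    (∃ κ : ℕ → ℕ, Tendsto κ atTop atTop ∧
      Tendsto (fun n => (κ n : ℝ) / (n : ℝ)) atTop (𝓝 0) ∧
      ∀ k : ℕ → ℕ, Tendsto k atTop atTop → (∀ᶠ n in atTop, k n ≤ κ n) →
        TendstoInDistribution
          (fun n ω => (omegaSample Y n (k n) ω - quantile μ (1 - 1 / (n : ℝ))) /
            (gumbelScale μ (n : ℝ) * omegaScale (k n))) atTop
          id (fun _ => P) (gaussianReal 0 1)) := by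
  exact proposition3_general hμ.hasLocallyLinearIncrements_logQuantile hlaw hindep hG
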